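/- Let $(N,g)$ be a smooth (Hausdorff) Riemannian manifold without boundary, of dimension $n\ge 1$ and not necessarily complete. For $x\in N$ let $\mathcal E_x\subseteq T_xN$ be the set of those $v$ for which the geodesic $\gamma_v$ of the Levi-Civita connection with $\gamma_v(0)=x$ and $\dot\gamma_v(0)=v$ is defined on an open interval containing $[0,1]$, and let $\exp_x\colon\mathcal E_x\to N$, $\exp_x(v)=\gamma_v(1)$, be the geodesic exponential map at $x$. Then for every $x\in N$ the set $\mathcal E_x$ is open in $T_xN$ and, for every $v\in\mathcal E_x$, the map $\exp_x$ is differentiable at $v$ and the kernel of its differential $$\mathrm d(\exp_x)_v\colon T_v(T_xN)\cong T_xN\to T_{\exp_x(v)}N$$ satisfies $$\dim\ker \mathrm d(\exp_x)_v<n .$$ -/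

import Mathlib

open scoped Manifold ContDiff Topology

noncomputable section

namespace RiemannianExp

variable {E : Type*} [NormedAddCommGroup E] [NormedSpace ℝ E]
  {M : Type*} [TopologicalSpace M] [ChartedSpace E M] [IsManifold 𝓘(ℝ, E) ∞ M]

/-- A smooth Riemannian metric on the (boundaryless) smooth manifold `M` modelled on `E`. -/
abbrev Metric (E : Type*) [NormedAddCommGroup E] [NormedSpace ℝ E]
    (M : Type*) [TopologicalSpace M] [ChartedSpace E M] [IsManifold 𝓘(ℝ, E) ∞ M] :=
  Bundle.ContMDiffRiemannianMetric 𝓘(ℝ, E) ∞ E (fun x : M ↦ TangentSpace 𝓘(ℝ, E) x)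

/-- The coordinate expression `p ↦ (g_{ij}(p))` of the metric in the preferred chart at `y`: the
pullback of `g` under the inverse of the chart. It is meaningful for `p` in the chart's target. -/
def localMetric (g : Metric E M) (y : M) (p : E) : E →L[ℝ] E →L[ℝ] ℝ :=
  let A : E →L[ℝ] E := mfderiv 𝓘(ℝ, E) 𝓘(ℝ, E) (extChartAt 𝓘(ℝ, E) y).symm p
  let B : E →L[ℝ] E →L[ℝ] ℝ := g.inner ((extChartAt 𝓘(ℝ, E) y).symm p)
  B.bilinearComp A A

/-- The Christoffel symbols of the first kind of the Levi-Civita connection in the chart at `y`,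
`Γ(u, v; w) = ½ (∂_u g(v, w) + ∂_v g(u, w) - ∂_w g(u, v))`; in terms of the usual symbols,
`Γ(u, v; w) = g (Γᵏ_{ij} uⁱ vʲ ∂_k, w)`. -/
def christoffel (g : Metric E M) (y : M) (p u v w : E) : ℝ :=
  (1 / 2 : ℝ) * (fderiv ℝ (localMetric g y) p u v w + fderiv ℝ (localMetric g y) p v u w
    - fderiv ℝ (localMetric g y) p w u v)

/-- `γ` is a geodesic of `g` on the open set `s` of times: it is `C²` there and, in every preferred
chart that contains `γ t`, its coordinate expression `c` satisfies the geodesic equation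
`c'' + Γ(c', c') = 0`, written with the free index lowered by `g`. -/
structure IsGeodesicOn (g : Metric E M) (γ : ℝ → M) (s : Set ℝ) : Prop where
  contMDiffOn : ContMDiffOn 𝓘(ℝ, ℝ) 𝓘(ℝ, E) 2 γ s
  equation : ∀ t ∈ s, ∀ y : M, γ t ∈ (chartAt E y).source →
    let c : ℝ → E := fun τ ↦ extChartAt 𝓘(ℝ, E) y (γ τ)
    ∀ w : E, localMetric g y (c t) (deriv (deriv c) t) w
      + christoffel g y (c t) (deriv c t) (deriv c t) w = 0

/-- `γ` is a geodesic on an open interval that contains `[0, 1]`, with `γ 0 = x` and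
`γ' 0 = v`. -/
def IsUnitGeodesicFrom (g : Metric E M) (x : M) (v : TangentSpace 𝓘(ℝ, E) x) (γ : ℝ → M) : Prop :=
  ∃ a b : ℝ, a < 0 ∧ 1 < b ∧ IsGeodesicOn g γ (Set.Ioo a b) ∧
    tangentMap 𝓘(ℝ, ℝ) 𝓘(ℝ, E) γ ⟨0, (1 : ℝ)⟩ = (⟨x, v⟩ : TangentBundle 𝓘(ℝ, E) M)

/-- The domain in `T_x M` of the exponential map at `x`: the initial velocities of geodesics that
start at `x` and exist up to time `1`. -/
def expDomain (g : Metric E M) (x : M) : Set (TangentSpace 𝓘(ℝ, E) x) :=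
  {v | ∃ γ : ℝ → M, IsUnitGeodesicFrom g x v γ}

open Classical in
/-- The exponential map `exp_x`, sending `v` to `γ 1` for the geodesic `γ` with `γ 0 = x` and
`γ' 0 = v` (on a Hausdorff manifold, `γ 1` does not depend on the choice of `γ`). Outside
`expDomain g x` the value is the dummy `x`. -/
def expMap (g : Metric E M) (x : M) (v : TangentSpace 𝓘(ℝ, E) x) : M :=
  if h : ∃ γ : ℝ → M, IsUnitGeodesicFrom g x v γ then h.choose 1 else x

end RiemannianExp

end

/-!
In a chart, geodesics are the base curves of the integral curves of the geodesic spray. The flow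
of a `C²` vector field depends differentiably on the initial condition, the derivative being the
solution of the first variation equation: Grönwall's inequality bounds the error quadratically.
Composing finitely many local flows along a geodesic then shows that geodesics with nearby initial
velocities exist for just as long and depend differentiably on them, so the domain of `exp_x` is
open and `exp_x` is differentiable on it.

The differential is nonzero because it does not kill a suitable radial vector. If `γ` is the
geodesic with `γ' 0 = v ≠ 0`, then `exp_x (s • v) = γ s`, hence `d(exp_x)_{s v} v = γ' s`. This is
nonzero, since by uniqueness a geodesic whose velocity vanishes at one time is constant. Taking
`s = 1` treats `v ≠ 0`; the origin is treated by `s = 0` and any nonzero initial velocity.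
-/

noncomputable section

namespace RiemannianExp

open Metric Set
open scoped NNReal

section LocalFlow

variable {F : Type*} [NormedAddCommGroup F] [NormedSpace ℝ F]

theorem exists_norm_fderiv_le_norm_sub_sub_fderiv_le {G : Type*} [NormedAddCommGroup G]
    [NormedSpace ℝ G] {f : F → G} {z₀ : F} (hf : ContDiffAt ℝ 2 f z₀) :
    ∃ s ∈ 𝓝 z₀, ∃ K C : ℝ≥0, ∀ a ∈ s, ‖fderiv ℝ f a‖ ≤ K ∧ ∀ b ∈ s,
      ‖f b - f a - fderiv ℝ f a (b - a)‖ ≤ C * ‖b - a‖ ^ 2 := by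
  have hf' : ContDiffAt ℝ 1 (fderiv ℝ f) z₀ := hf.fderiv_right (by norm_num)
  obtain ⟨C, s, hs, hC⟩ := hf'.exists_lipschitzOnWith
  have hdiff : ∀ᶠ z in 𝓝 z₀, DifferentiableAt ℝ f z := by
    filter_upwards [hf.eventually (by simp)] with z hz using hz.differentiableAt (by norm_num)
  have hbound : ∀ᶠ z in 𝓝 z₀, ‖fderiv ℝ f z‖ < ‖fderiv ℝ f z₀‖ + 1 :=
    hf'.continuousAt.norm.eventually_lt_const (by linarith)
  obtain ⟨ρ, hρ, h⟩ := eventually_nhds_iff_ball.1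
    (hdiff.and (hbound.and (Filter.eventually_mem_set.2 hs)))
  refine ⟨ball z₀ ρ, ball_mem_nhds z₀ hρ, ‖fderiv ℝ f z₀‖₊ + 1, C,
    fun a ha ↦ ⟨(h a ha).2.1.le, fun b hb ↦ ?_⟩⟩
  have hseg : segment ℝ a b ⊆ ball z₀ ρ := (convex_ball z₀ ρ).segment_subset ha hb
  have hfderiv : ∀ z ∈ segment ℝ a b, ‖fderiv ℝ f z - fderiv ℝ f a‖ ≤ C * ‖b - a‖ := fun z hz ↦
    ((hC.norm_sub_le (h z (hseg hz)).2.2 (h a ha).2.2).trans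
      (by gcongr; exact norm_sub_le_of_mem_segment hz))
  simpa only [pow_two, mul_assoc] using
    (convex_segment a b).norm_image_sub_le_of_norm_hasFDerivWithin_le'
      (fun z hz ↦ (h z (hseg hz)).1.hasFDerivAt.hasFDerivWithinAt) hfderiv
      (left_mem_segment ℝ a b) (right_mem_segment ℝ a b)

theorem norm_sub_sub_firstVariation_le_gronwallBound {f : F → F} {f' : F → F →L[ℝ] F} {s : Set F}
    {K C B T : ℝ} {φ ψ : ℝ → F} {X : ℝ → F →L[ℝ] F} (hf' : ∀ a ∈ s, ‖f' a‖ ≤ K)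
    (hf : ∀ a ∈ s, ∀ b ∈ s, ‖f b - f a - f' a (b - a)‖ ≤ C * ‖b - a‖ ^ 2)
    (hC : 0 ≤ C) (hT : 0 ≤ T)
    (hφ : ∀ t ∈ Icc 0 T, φ t ∈ s ∧ HasDerivAt φ (f (φ t)) t)
    (hψ : ∀ t ∈ Icc 0 T, ψ t ∈ s ∧ HasDerivAt ψ (f (ψ t)) t)
    (hX : ∀ t ∈ Icc 0 T, HasDerivAt X ((f' (φ t)).comp (X t)) t)
    (hX₀ : X 0 = ContinuousLinearMap.id ℝ F) (hB : ∀ t ∈ Icc 0 T, ‖ψ t - φ t‖ ≤ B) :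
    ‖ψ T - φ T - X T (ψ 0 - φ 0)‖ ≤ gronwallBound 0 K (C * B ^ 2) T := by
  set r : ℝ → F := fun t ↦ ψ t - φ t - X t (ψ 0 - φ 0) with hr
  have hr' : ∀ t ∈ Icc 0 T, HasDerivAt r
      (f' (φ t) (r t) + (f (ψ t) - f (φ t) - f' (φ t) (ψ t - φ t))) t := fun t ht ↦ by
    have hXv := (hX t ht).clm_apply (hasDerivAt_const t (ψ 0 - φ 0))
    convert! ((hψ t ht).2.sub (hφ t ht).2).sub hXv using 1
    simp only [hr, map_sub, map_zero, add_zero, ContinuousLinearMap.comp_apply]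
    abel
  have hle : ∀ t ∈ Ico 0 T, ‖f' (φ t) (r t) + (f (ψ t) - f (φ t) - f' (φ t) (ψ t - φ t))‖ ≤
      K * ‖r t‖ + C * B ^ 2 := fun t ht ↦ by
    have ht' := Ico_subset_Icc_self ht
    refine (norm_add_le _ _).trans (add_le_add ?_ ?_)
    · exact (f' (φ t)).le_of_opNorm_le (hf' _ (hφ t ht').1) _
    · exact (hf _ (hφ t ht').1 _ (hψ t ht').1).trans (by gcongr; exact hB t ht')
  simpa only [sub_zero] using norm_le_gronwallBound_of_norm_deriv_right_le
    (fun t ht ↦ (hr' t ht).continuousAt.continuousWithinAt)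
    (fun t ht ↦ (hr' t (Ico_subset_Icc_self ht)).hasDerivWithinAt)
    (by simp [hr, hX₀]) hle T (right_mem_Icc.2 hT)

theorem gronwallBound_zero_mul (K c d t : ℝ) :
    gronwallBound 0 K (c * d) t = gronwallBound 0 K c t * d := by
  unfold gronwallBound
  split_ifs <;> ring

theorem exists_localFlow_lipschitzOnWith [CompleteSpace F] {f : F → F} {z₀ : F}
    (hf : ContDiffAt ℝ 1 f z₀) {s : Set F} (hs : s ∈ 𝓝 z₀) :
    ∃ ε > 0, ∃ L : ℝ≥0, ∃ Φ : F → ℝ → F,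
      (∀ z ∈ ball z₀ ε, Φ z 0 = z ∧
        ∀ t ∈ Ioo (-ε) ε, Φ z t ∈ s ∧ HasDerivAt (Φ z) (f (Φ z t)) t) ∧
      ∀ t ∈ Ioo (-ε) ε, LipschitzOnWith L (fun z ↦ Φ z t) (ball z₀ ε) := by
  obtain ⟨δ, hδ, A, R, L, K, hR, hpl⟩ := IsPicardLindelof.of_contDiffAt_one hf
  obtain ⟨Φ, hΦ, L', hL'⟩ :=
    (hpl 0).exists_forall_mem_closedBall_eq_hasDerivWithinAt_lipschitzOnWith
  simp only [zero_sub, zero_add] at hΦ hL'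
  have hR' : (0 : ℝ) < R := hR
  have hcont : ContinuousAt (Function.uncurry Φ) (z₀, 0) :=
    (continuousOn_prod_of_continuousOn_lipschitzOnWith _ L'
      (fun z hz ↦ HasDerivWithinAt.continuousOn (hΦ z hz).2) hL').continuousAt
      (prod_mem_nhds (closedBall_mem_nhds _ hR') (Icc_mem_nhds (by linarith) hδ))
  have hmem : ∀ᶠ q in 𝓝 (z₀, (0 : ℝ)), Function.uncurry Φ q ∈ s := by
    refine hcont.eventually_mem ?_
    rwa [Function.uncurry_apply_pair, (hΦ z₀ (mem_closedBall_self hR'.le)).1]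
  obtain ⟨η, hη, hball⟩ := eventually_nhds_iff_ball.1 hmem
  have hεη : min η (min δ R) ≤ η := min_le_left _ _
  have hεδ : min η (min δ R) ≤ δ := (min_le_right _ _).trans (min_le_left _ _)
  have hεR : ball z₀ (min η (min δ R)) ⊆ closedBall z₀ R :=
    (ball_subset_ball ((min_le_right _ _).trans (min_le_right _ _))).trans ball_subset_closedBall
  have htime : ∀ {t}, t ∈ Ioo (-min η (min δ R)) (min η (min δ R)) → t ∈ Ioo (-δ) δ :=
    fun ht ↦ Ioo_subset_Ioo (neg_le_neg hεδ) hεδ ht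
  refine ⟨min η (min δ R), by positivity, L', Φ,
    fun z hz ↦ ⟨(hΦ z (hεR hz)).1, fun t ht ↦ ⟨?_, ?_⟩⟩,
    fun t ht ↦ (hL' t (Ioo_subset_Icc_self (htime ht))).mono hεR⟩
  · refine hball (z, t) ?_
    rw [mem_ball, Prod.dist_eq, max_lt_iff]
    exact ⟨(mem_ball.1 hz).trans_le hεη, by simpa [abs_lt] using (abs_lt.2 ht).trans_le hεη⟩
  · exact ((hΦ z (hεR hz)).2 t (Ioo_subset_Icc_self (htime ht))).hasDerivAt
      (Icc_mem_nhds (htime ht).1 (htime ht).2)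

/-- The vector field on `F × (F →L[ℝ] F)` whose integral curves `(φ, X)` consist of an integral
curve `φ` of `f` and of a solution `X` of the first variation equation `X' = f'(φ) ∘ X` along it;
for `X 0 = id`, the operator `X t` is the derivative of the flow of `f` at time `t`. -/
def firstVariationField (f : F → F) (q : F × (F →L[ℝ] F)) : F × (F →L[ℝ] F) :=
  (f q.1, (fderiv ℝ f q.1).comp q.2)

theorem contDiffAt_firstVariationField {f : F → F} {q : F × (F →L[ℝ] F)} {n : WithTop ℕ∞}
    (hf : ContDiffAt ℝ (n + 1) f q.1) : ContDiffAt ℝ n (firstVariationField f) q :=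
  ContDiffAt.prodMk (ContDiffAt.comp q (hf.of_le le_self_add) contDiffAt_fst)
    ((ContDiffAt.comp q (hf.fderiv_right le_rfl) contDiffAt_fst).clm_comp contDiffAt_snd)

/-- Rescaling time by `t` reduces both signs of `t` to the Grönwall estimate on `[0, 1]`. -/
theorem norm_flow_sub_sub_firstVariation_le {f : F → F} {f' : F → F →L[ℝ] F} {s : Set F}
    {K C B t : ℝ} {φ ψ : ℝ → F} {X : ℝ → F →L[ℝ] F} (hf' : ∀ a ∈ s, ‖f' a‖ ≤ K)
    (hf : ∀ a ∈ s, ∀ b ∈ s, ‖f b - f a - f' a (b - a)‖ ≤ C * ‖b - a‖ ^ 2) (hC : 0 ≤ C)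
    (hφ : ∀ τ ∈ uIcc 0 t, φ τ ∈ s ∧ HasDerivAt φ (f (φ τ)) τ)
    (hψ : ∀ τ ∈ uIcc 0 t, ψ τ ∈ s ∧ HasDerivAt ψ (f (ψ τ)) τ)
    (hX : ∀ τ ∈ uIcc 0 t, HasDerivAt X ((f' (φ τ)).comp (X τ)) τ)
    (hX₀ : X 0 = ContinuousLinearMap.id ℝ F) (hB : ∀ τ ∈ uIcc 0 t, ‖ψ τ - φ τ‖ ≤ B) :
    ‖ψ t - φ t - X t (ψ 0 - φ 0)‖ ≤ gronwallBound 0 (|t| * K) (|t| * C) 1 * B ^ 2 := by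
  have hmem : ∀ τ ∈ Icc (0 : ℝ) 1, t * τ ∈ uIcc 0 t := fun τ hτ ↦ by
    rw [← segment_eq_uIcc, segment_eq_image]
    exact ⟨τ, hτ, by simp [mul_comm]⟩
  have hder : ∀ {H : Type _} [NormedAddCommGroup H] [NormedSpace ℝ H] {c : ℝ → H} {c' : H} {τ : ℝ},
      HasDerivAt c c' (t * τ) → HasDerivAt (fun τ ↦ c (t * τ)) (t • c') τ := fun h ↦ by
    simpa [Function.comp_def] using h.scomp_of_eq _ ((hasDerivAt_id _).const_mul t) rfl
  have := norm_sub_sub_firstVariation_le_gronwallBound (f := fun z ↦ t • f z)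
    (f' := fun z ↦ t • f' z) (s := s) (K := |t| * K) (C := |t| * C) (B := B) (T := 1)
    (φ := fun τ ↦ φ (t * τ)) (ψ := fun τ ↦ ψ (t * τ)) (X := fun τ ↦ X (t * τ))
    (fun a ha ↦ by rw [norm_smul, Real.norm_eq_abs]; gcongr; exact hf' a ha)
    (fun a ha b hb ↦ by
      rw [smul_apply, ← smul_sub, ← smul_sub, norm_smul, Real.norm_eq_abs,
        mul_assoc]
      gcongr
      exact hf a ha b hb)
    (by positivity) zero_le_one
    (fun τ hτ ↦ ⟨(hφ _ (hmem τ hτ)).1, hder (hφ _ (hmem τ hτ)).2⟩)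
    (fun τ hτ ↦ ⟨(hψ _ (hmem τ hτ)).1, hder (hψ _ (hmem τ hτ)).2⟩)
    (fun τ hτ ↦ by simpa only [ContinuousLinearMap.smul_comp] using hder (hX _ (hmem τ hτ)))
    (by simpa using hX₀) (fun τ hτ ↦ hB _ (hmem τ hτ))
  simpa only [mul_one, mul_zero, gronwallBound_zero_mul] using this

theorem exists_localFlow_differentiableAt [CompleteSpace F] {f : F → F} {z₀ : F}
    (hf : ContDiffAt ℝ 2 f z₀) {s : Set F} (hs : s ∈ 𝓝 z₀) :
    ∃ ε > 0, ∃ Φ : F → ℝ → F, ∀ z ∈ ball z₀ ε, Φ z 0 = z ∧ ∀ t ∈ Ioo (-ε) ε,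
      Φ z t ∈ s ∧ HasDerivAt (Φ z) (f (Φ z t)) t ∧ DifferentiableAt ℝ (fun y ↦ Φ y t) z := by
  obtain ⟨u, hu, K, C, hKC⟩ := exists_norm_fderiv_le_norm_sub_sub_fderiv_le hf
  obtain ⟨ε, hε, L, Ψ, hΨ, hL⟩ := exists_localFlow_lipschitzOnWith
    (contDiffAt_firstVariationField (q := (z₀, ContinuousLinearMap.id ℝ F)) (n := 1)
      (by simpa [one_add_one_eq_two] using hf))
    (prod_mem_nhds (Filter.inter_mem hs hu) Filter.univ_mem)
  let ι : F → F × (F →L[ℝ] F) := fun z ↦ (z, ContinuousLinearMap.id ℝ F)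
  have hι : ∀ z ∈ ball z₀ ε, ι z ∈ ball (ι z₀) ε := fun z hz ↦ by
    simpa [ι, Prod.dist_eq] using hz
  have hflow : ∀ z ∈ ball z₀ ε, ∀ t ∈ Ioo (-ε) ε, (Ψ (ι z) t).1 ∈ s ∩ u ∧
      HasDerivAt (fun t ↦ (Ψ (ι z) t).1) (f (Ψ (ι z) t).1) t := fun z hz t ht ↦
    ⟨((hΨ _ (hι z hz)).2 t ht).1.1, ((hΨ _ (hι z hz)).2 t ht).2.fst⟩
  have hinit : ∀ z ∈ ball z₀ ε, Ψ (ι z) 0 = ι z := fun z hz ↦ (hΨ _ (hι z hz)).1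
  refine ⟨ε, hε, fun z t ↦ (Ψ (ι z) t).1, fun z hz ↦ ⟨congrArg Prod.fst (hinit z hz), fun t ht ↦
    ⟨(hflow z hz t ht).1.1, (hflow z hz t ht).2, HasFDerivAt.differentiableAt (f' := (Ψ (ι z) t).2)
      (.of_isLittleO (Asymptotics.IsBigO.trans_isLittleO (g := fun y ↦ ‖y - z‖ ^ 2) (.of_bound
        (gronwallBound 0 (|t| * K) (|t| * C) 1 * L ^ 2) ?_)
        (Asymptotics.isLittleO_pow_sub_sub z one_lt_two)))⟩⟩⟩
  have htime : uIcc 0 t ⊆ Ioo (-ε) ε := (ordConnected_Ioo.uIcc_subset ⟨by linarith, hε⟩ ht)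
  filter_upwards [isOpen_ball.mem_nhds hz] with y hy
  have hlip : ∀ τ ∈ Ioo (-ε) ε, ‖(Ψ (ι y) τ).1 - (Ψ (ι z) τ).1‖ ≤ L * ‖y - z‖ := fun τ hτ ↦
    (norm_fst_le (Ψ (ι y) τ - Ψ (ι z) τ)).trans
      (((hL τ hτ).norm_sub_le (hι y hy) (hι z hz)).trans_eq (by simp [ι, Prod.norm_def]))
  have hbound := norm_flow_sub_sub_firstVariation_le (s := u) (t := t) (fun a ha ↦ (hKC a ha).1)
    (fun a ha b hb ↦ (hKC a ha).2 b hb) C.2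
    (fun τ hτ ↦ ⟨(hflow z hz τ (htime hτ)).1.2, (hflow z hz τ (htime hτ)).2⟩)
    (fun τ hτ ↦ ⟨(hflow y hy τ (htime hτ)).1.2, (hflow y hy τ (htime hτ)).2⟩)
    (fun τ hτ ↦ ((hΨ _ (hι z hz)).2 τ (htime hτ)).2.snd)
    (by rw [hinit z hz]) (fun τ hτ ↦ hlip τ (htime hτ))
  rw [hinit y hy, hinit z hz] at hbound
  simpa [mul_pow, mul_assoc] using hbound

end LocalFlow

section Coordinates

variable {F : Type*} [NormedAddCommGroup F] [NormedSpace ℝ F]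
  {F' : Type*} [NormedAddCommGroup F'] [NormedSpace ℝ F']

/-- The linear form `w ↦ Γ(v, v; w)` at `q = (p, v)`, where `Γ` are the Christoffel symbols of the
first kind of a field `G` of symmetric bilinear forms on a normed space. Only equal first
arguments enter the geodesic equation, so that `Γ(v, v; w) = ∂_v G(v, w) - ½ ∂_w G(v, v)`. -/
def christoffelForm (G : F → F →L[ℝ] F →L[ℝ] ℝ) (q : F × F) : F →L[ℝ] ℝ :=
  fderiv ℝ G q.1 q.2 q.2 - (1 / 2 : ℝ) •
    ((ContinuousLinearMap.apply ℝ ℝ q.2).comp (ContinuousLinearMap.apply ℝ (F →L[ℝ] ℝ) q.2)).comp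
      (fderiv ℝ G q.1)

/-- The geodesic equation of a field `G` of symmetric bilinear forms, with its free index lowered,
for a curve in a normed space. -/
def GeodesicEquationAt (G : F → F →L[ℝ] F →L[ℝ] ℝ) (c : ℝ → F) (t : ℝ) : Prop :=
  G (c t) (deriv (deriv c) t) + christoffelForm G (c t, deriv c t) = 0

/-- The geodesic spray, the vector field on `F × F` whose integral curves are the pairs `(c, c')`
with `c` a solution of the geodesic equation. It is meaningful where `G` is nondegenerate. -/
def spray (G : F → F →L[ℝ] F →L[ℝ] ℝ) (q : F × F) : F × F :=
  (q.2, -(G q.1).inverse (christoffelForm G q))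

/-- The pullback under `φ` of a field of bilinear forms. -/
def pullbackForm (φ : F → F') (G : F' → F' →L[ℝ] F' →L[ℝ] ℝ) (p : F) : F →L[ℝ] F →L[ℝ] ℝ :=
  (G (φ p)).bilinearComp (fderiv ℝ φ p) (fderiv ℝ φ p)

theorem christoffelForm_apply (G : F → F →L[ℝ] F →L[ℝ] ℝ) (p v w : F) :
    christoffelForm G (p, v) w = fderiv ℝ G p v v w - 1 / 2 * fderiv ℝ G p w v v := by
  simp [christoffelForm]

theorem christoffelForm_smul (G : F → F →L[ℝ] F →L[ℝ] ℝ) (p v : F) (s : ℝ) :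
    christoffelForm G (p, s • v) = (s * s) • christoffelForm G (p, v) := by
  ext w
  simp [christoffelForm_apply]
  ring

set_option maxSynthPendingDepth 5 in
theorem contDiffAt_christoffelForm {G : F → F →L[ℝ] F →L[ℝ] ℝ} {q : F × F} {n : WithTop ℕ∞}
    (hG : ContDiffAt ℝ (n + 1) G q.1) : ContDiffAt ℝ n (christoffelForm G) q := by
  have hDG : ContDiffAt ℝ n (fun q : F × F ↦ fderiv ℝ G q.1) q :=
    ContDiffAt.comp q (hG.fderiv_right le_rfl) contDiffAt_fst
  have heval : ContDiffAt ℝ n (fun q : F × F ↦ (ContinuousLinearMap.apply ℝ ℝ q.2).comp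
      (ContinuousLinearMap.apply ℝ (F →L[ℝ] ℝ) q.2)) q :=
    ContDiffAt.clm_comp
      (ContDiffAt.comp q (ContinuousLinearMap.contDiff _).contDiffAt contDiffAt_snd)
      (ContDiffAt.comp q (ContinuousLinearMap.contDiff _).contDiffAt contDiffAt_snd)
  exact ((hDG.clm_apply contDiffAt_snd).clm_apply contDiffAt_snd).sub
    ((heval.clm_comp hDG).const_smul (1 / 2 : ℝ))

theorem deriv_deriv_comp {φ : F → F'} {c : ℝ → F} {t : ℝ} (hφ : ContDiffAt ℝ 2 φ (c t))
    (hc : ContDiffAt ℝ 2 c t) :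
    deriv (deriv (φ ∘ c)) t = fderiv ℝ (fderiv ℝ φ) (c t) (deriv c t) (deriv c t) +
      fderiv ℝ φ (c t) (deriv (deriv c) t) := by
  have hderiv : deriv (φ ∘ c) =ᶠ[𝓝 t] fun τ ↦ fderiv ℝ φ (c τ) (deriv c τ) := by
    filter_upwards [hc.continuousAt.eventually (hφ.eventually (by simp)), hc.eventually (by simp)]
      with τ hφτ hcτ
    exact fderiv_comp_deriv τ (hφτ.differentiableAt (by simp)) (hcτ.differentiableAt (by simp))
  have hφ' := ((hφ.fderiv_right (m := 1) (by norm_num)).differentiableAt (by simp)).hasFDerivAt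
  rw [hderiv.deriv_eq]
  exact ((hφ'.comp_hasDerivAt t (hc.differentiableAt (by simp)).hasDerivAt).clm_apply
    ((hc.derivWithin (m := 1) (by norm_num)).differentiableAt (by simp)).hasDerivAt).deriv

theorem fderiv_pullbackForm_apply {φ : F → F'} {G : F → F →L[ℝ] F →L[ℝ] ℝ}
    {G' : F' → F' →L[ℝ] F' →L[ℝ] ℝ} {p : F} (hφ : ContDiffAt ℝ 2 φ p)
    (hG : DifferentiableAt ℝ G p) (hG' : DifferentiableAt ℝ G' (φ p))
    (h : G =ᶠ[𝓝 p] pullbackForm φ G') (a u w : F) :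
    fderiv ℝ G p a u w =
      fderiv ℝ G' (φ p) (fderiv ℝ φ p a) (fderiv ℝ φ p u) (fderiv ℝ φ p w)
        + G' (φ p) (fderiv ℝ (fderiv ℝ φ) p a u) (fderiv ℝ φ p w)
        + G' (φ p) (fderiv ℝ φ p u) (fderiv ℝ (fderiv ℝ φ) p a w) := by
  have hφ₁ : HasFDerivAt φ (fderiv ℝ φ p) p := (hφ.differentiableAt (by simp)).hasFDerivAt
  have hφ₂ : HasFDerivAt (fderiv ℝ φ) (fderiv ℝ (fderiv ℝ φ) p) p :=
    ((hφ.fderiv_right (m := 1) (by norm_num)).differentiableAt (by simp)).hasFDerivAt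
  have hG'φ : HasFDerivAt (fun q ↦ G' (φ q)) ((fderiv ℝ G' (φ p)).comp (fderiv ℝ φ p)) p :=
    HasFDerivAt.comp (g := G') p hG'.hasFDerivAt hφ₁
  have hleft := (hG.hasFDerivAt.clm_apply (hasFDerivAt_const u p)).clm_apply (hasFDerivAt_const w p)
  have hright := (hG'φ.clm_apply
    (hφ₂.clm_apply (hasFDerivAt_const u p))).clm_apply (hφ₂.clm_apply (hasFDerivAt_const w p))
  have heq := DFunLike.congr_fun (hleft.unique (hright.congr_of_eventuallyEq
    (h.mono fun q hq ↦ by simp [hq, pullbackForm]))) a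
  simp only [ContinuousLinearMap.comp_zero, zero_add, ContinuousLinearMap.flip_apply,
    ContinuousLinearMap.flip_add, add_apply, ContinuousLinearMap.comp_apply] at heq
  rw [heq]
  ring

theorem christoffelForm_apply_of_eventuallyEq_pullbackForm {φ : F → F'}
    {G : F → F →L[ℝ] F →L[ℝ] ℝ} {G' : F' → F' →L[ℝ] F' →L[ℝ] ℝ} {p : F}
    (hφ : ContDiffAt ℝ 2 φ p) (hG : DifferentiableAt ℝ G p) (hG' : DifferentiableAt ℝ G' (φ p))
    (hsymm : ∀ u w, G' (φ p) u w = G' (φ p) w u) (h : G =ᶠ[𝓝 p] pullbackForm φ G') (v w : F) :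
    christoffelForm G (p, v) w = christoffelForm G' (φ p, fderiv ℝ φ p v) (fderiv ℝ φ p w) +
      G' (φ p) (fderiv ℝ (fderiv ℝ φ) p v v) (fderiv ℝ φ p w) := by
  have hφsymm : IsSymmSndFDerivAt ℝ φ p := hφ.isSymmSndFDerivAt (by simp)
  simp only [christoffelForm_apply, fderiv_pullbackForm_apply hφ hG hG' h]
  rw [hφsymm.eq w v, hsymm (fderiv ℝ φ p v)]
  ring

theorem GeodesicEquationAt.comp {φ : F → F'} {G : F → F →L[ℝ] F →L[ℝ] ℝ}
    {G' : F' → F' →L[ℝ] F' →L[ℝ] ℝ} {c : ℝ → F} {t : ℝ} (h : GeodesicEquationAt G c t)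
    (hc : ContDiffAt ℝ 2 c t) (hφ : ContDiffAt ℝ 2 φ (c t))
    (hsurj : Function.Surjective (fderiv ℝ φ (c t)))
    (hG : DifferentiableAt ℝ G (c t)) (hG' : DifferentiableAt ℝ G' (φ (c t)))
    (hsymm : ∀ u w, G' (φ (c t)) u w = G' (φ (c t)) w u)
    (hpull : G =ᶠ[𝓝 (c t)] pullbackForm φ G') : GeodesicEquationAt G' (φ ∘ c) t := by
  refine ContinuousLinearMap.ext fun w' ↦ ?_
  obtain ⟨w, rfl⟩ := hsurj w'
  have hderiv : deriv (φ ∘ c) t = fderiv ℝ φ (c t) (deriv c t) :=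
    fderiv_comp_deriv t (hφ.differentiableAt (by simp)) (hc.differentiableAt (by simp))
  have hw := DFunLike.congr_fun h w
  simp only [add_apply, zero_apply, hpull.eq_of_nhds,
    christoffelForm_apply_of_eventuallyEq_pullbackForm hφ hG hG' hsymm hpull] at hw
  simp only [pullbackForm, ContinuousLinearMap.bilinearComp_apply] at hw
  simp only [add_apply, zero_apply, Function.comp_apply, hderiv, deriv_deriv_comp hφ hc, map_add]
  linear_combination hw

theorem GeodesicEquationAt.congr_of_eventuallyEq {G : F → F →L[ℝ] F →L[ℝ] ℝ} {c₁ c₂ : ℝ → F}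
    {t : ℝ} (h : GeodesicEquationAt G c₁ t) (hc : c₂ =ᶠ[𝓝 t] c₁) : GeodesicEquationAt G c₂ t := by
  rwa [GeodesicEquationAt, hc.eq_of_nhds, hc.deriv_eq, hc.deriv.deriv_eq]

theorem deriv_comp_mul_add (c : ℝ → F) (s r : ℝ) :
    deriv (fun t ↦ c (s * t + r)) = fun t ↦ s • deriv c (s * t + r) := by
  funext t
  rw [deriv_comp_mul_left s (fun t ↦ c (t + r)) t, deriv_comp_add_const]

theorem GeodesicEquationAt.comp_mul_add {G : F → F →L[ℝ] F →L[ℝ] ℝ} {c : ℝ → F} {s r t : ℝ}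
    (h : GeodesicEquationAt G c (s * t + r)) :
    GeodesicEquationAt G (fun t ↦ c (s * t + r)) t := by
  have hdd : deriv (deriv fun t ↦ c (s * t + r)) t = (s * s) • deriv (deriv c) (s * t + r) := by
    rw [deriv_comp_mul_add, deriv_fun_const_smul_field, deriv_comp_mul_add, smul_smul]
  rw [GeodesicEquationAt, hdd, deriv_comp_mul_add, christoffelForm_smul, map_smul, ← smul_add, h,
    smul_zero]

theorem geodesicEquationAt_iff {G : F → F →L[ℝ] F →L[ℝ] ℝ} {c : ℝ → F} {t : ℝ}
    (hG : (G (c t)).IsInvertible) :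
    GeodesicEquationAt G c t ↔ deriv (deriv c) t = (spray G (c t, deriv c t)).2 := by
  rw [GeodesicEquationAt, spray, add_eq_zero_iff_eq_neg]
  obtain ⟨e, he⟩ := hG
  simp [← he, ← e.eq_symm_apply]

theorem contDiffAt_spray [CompleteSpace F] {G : F → F →L[ℝ] F →L[ℝ] ℝ} {q : F × F}
    {n : WithTop ℕ∞} (hG : ContDiffAt ℝ (n + 1) G q.1) (hinv : (G q.1).IsInvertible) :
    ContDiffAt ℝ n (spray G) q :=
  contDiffAt_snd.prodMk ((ContDiffAt.clm_apply (ContDiffAt.comp q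
    (g := ContinuousLinearMap.inverse) (f := fun q : F × F ↦ G q.1) hinv.contDiffAt_map_inverse
      (ContDiffAt.comp q (hG.of_le le_self_add) contDiffAt_fst))
    (contDiffAt_christoffelForm hG)).neg)

theorem GeodesicEquationAt.hasDerivAt_prodMk_deriv {G : F → F →L[ℝ] F →L[ℝ] ℝ} {c : ℝ → F} {t : ℝ}
    (h : GeodesicEquationAt G c t) (hc : ContDiffAt ℝ 2 c t) (hG : (G (c t)).IsInvertible) :
    HasDerivAt (fun t ↦ (c t, deriv c t)) (spray G (c t, deriv c t)) t := by
  have := (hc.differentiableAt (by simp)).hasDerivAt.prodMk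
    (((hc.derivWithin (m := 1) (by norm_num)).differentiableAt (by simp)).hasDerivAt)
  rwa [(geodesicEquationAt_iff hG).1 h] at this

theorem hasDerivAt_fst_of_hasDerivAt_spray {G : F → F →L[ℝ] F →L[ℝ] ℝ} {q : ℝ → F × F} {t : ℝ}
    (hq : HasDerivAt q (spray G (q t)) t) : HasDerivAt (fun τ ↦ (q τ).1) (q t).2 t :=
  hq.fst

theorem contDiffOn_fst_of_hasDerivAt_spray [CompleteSpace F] {G : F → F →L[ℝ] F →L[ℝ] ℝ}
    {q : ℝ → F × F} {s : Set ℝ} (hs : IsOpen s) (hq : ∀ t ∈ s, HasDerivAt q (spray G (q t)) t)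
    (hG : ∀ t ∈ s, ContDiffAt ℝ 1 G (q t).1) (hinv : ∀ t ∈ s, (G (q t).1).IsInvertible) :
    ContDiffOn ℝ 2 (fun t ↦ (q t).1) s := by
  have hfst := fun t ht ↦ hasDerivAt_fst_of_hasDerivAt_spray (hq t ht)
  have hcont : ContinuousOn (fun t ↦ spray G (q t)) s := fun t ht ↦
    (ContinuousAt.comp (g := spray G) (contDiffAt_spray (n := 0) (by simpa using hG t ht)
      (hinv t ht)).continuousAt (hq t ht).continuousAt).continuousWithinAt
  have hq₁ : ContDiffOn ℝ 1 q s := by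
    rw [show (1 : WithTop ℕ∞) = 0 + 1 from rfl, contDiffOn_succ_iff_deriv_of_isOpen hs,
      contDiffOn_zero]
    exact ⟨fun t ht ↦ (hq t ht).differentiableAt.differentiableWithinAt, by simp,
      hcont.congr fun t ht ↦ (hq t ht).deriv⟩
  rw [← one_add_one_eq_two, contDiffOn_succ_iff_deriv_of_isOpen hs]
  exact ⟨fun t ht ↦ (hfst t ht).differentiableAt.differentiableWithinAt, by simp,
    hq₁.snd.congr fun t ht ↦ (hfst t ht).deriv⟩

theorem geodesicEquationAt_fst_of_hasDerivAt_spray {G : F → F →L[ℝ] F →L[ℝ] ℝ} {q : ℝ → F × F}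
    {t : ℝ} (hq : ∀ᶠ τ in 𝓝 t, HasDerivAt q (spray G (q τ)) τ) (hinv : (G (q t).1).IsInvertible) :
    GeodesicEquationAt G (fun τ ↦ (q τ).1) t := by
  have hderiv : deriv (fun τ ↦ (q τ).1) =ᶠ[𝓝 t] fun τ ↦ (q τ).2 :=
    hq.mono fun τ hτ ↦ (hasDerivAt_fst_of_hasDerivAt_spray hτ).deriv
  have hsnd : HasDerivAt (fun τ ↦ (q τ).2) (spray G (q t)).2 t := hq.self_of_nhds.snd
  rw [geodesicEquationAt_iff hinv, hderiv.deriv_eq, hsnd.deriv,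
    hderiv.eq_of_nhds]

end Coordinates

theorem t2Space_totalSpace {B F : Type*} [TopologicalSpace B] [TopologicalSpace F] {V : B → Type*}
    [TopologicalSpace (Bundle.TotalSpace F V)] [∀ b, TopologicalSpace (V b)] [FiberBundle F V]
    [T2Space B] [T2Space F] : T2Space (Bundle.TotalSpace F V) := by
  refine ⟨fun p q hpq ↦ ?_⟩
  by_cases hproj : p.proj = q.proj
  · let e := trivializationAt F V p.proj
    have hp : p ∈ e.source := FiberBundle.mem_trivializationAt_proj_source
    have hq : q ∈ e.source := e.mem_source.2 (hproj ▸ e.mem_source.1 hp)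
    have : T2Space e.source := e.toOpenPartialHomeomorph.toHomeomorphSourceTarget.symm.t2Space
    exact separated_by_isOpenEmbedding e.open_source.isOpenEmbedding_subtypeVal
      (x := ⟨p, hp⟩) (y := ⟨q, hq⟩) (by simpa using hpq)
  · exact separated_by_continuous (FiberBundle.continuous_proj F V) hproj

variable {E : Type*} [NormedAddCommGroup E] [NormedSpace ℝ E]
  {M : Type*} [TopologicalSpace M] [ChartedSpace E M]

section LocalMetric

theorem extChartAt_mem_target {m y : M} (hm : m ∈ (chartAt E y).source) :
    extChartAt 𝓘(ℝ, E) y m ∈ (extChartAt 𝓘(ℝ, E) y).target :=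
  (extChartAt 𝓘(ℝ, E) y).map_source (by rwa [extChartAt_source])

/-- The coordinate change from the preferred chart at `y` to the preferred chart at `z`. -/
def coordChange (E : Type*) [NormedAddCommGroup E] [NormedSpace ℝ E] {M : Type*}
    [TopologicalSpace M] [ChartedSpace E M] (y z : M) : E → E :=
  extChartAt 𝓘(ℝ, E) z ∘ (extChartAt 𝓘(ℝ, E) y).symm

theorem coordChange_extChartAt {y z m : M} (hm : m ∈ (chartAt E y).source) :
    coordChange E y z (extChartAt 𝓘(ℝ, E) y m) = extChartAt 𝓘(ℝ, E) z m := by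
  simp [coordChange, hm]

theorem extChartAt_eventuallyEq_coordChange_comp {y z m : M} (hm : m ∈ (chartAt E y).source) :
    extChartAt 𝓘(ℝ, E) z =ᶠ[𝓝 m] coordChange E y z ∘ extChartAt 𝓘(ℝ, E) y := by
  filter_upwards [(chartAt E y).open_source.mem_nhds hm] with q hq
  exact (coordChange_extChartAt hq).symm

theorem eventually_nhds_extChartAt_iff {y m : M} (hm : m ∈ (chartAt E y).source) {P : E → Prop} :
    (∀ᶠ p in 𝓝 (extChartAt 𝓘(ℝ, E) y m), P p) ↔ ∀ᶠ q in 𝓝 m, P (extChartAt 𝓘(ℝ, E) y q) := by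
  have hmap := map_extChartAt_nhds' (I := 𝓘(ℝ, E)) (x := y) (y := m) (by simpa using hm)
  rw [modelWithCornersSelf_coe, range_id, nhdsWithin_univ] at hmap
  rw [← hmap, Filter.eventually_map]

variable [IsManifold 𝓘(ℝ, E) ∞ M]

theorem contDiffAt_coordChange {y z m : M} (hy : m ∈ (chartAt E y).source)
    (hz : m ∈ (chartAt E z).source) :
    ContDiffAt ℝ ∞ (coordChange E y z) (extChartAt 𝓘(ℝ, E) y m) := by
  have hchange := contDiffWithinAt_ext_coord_change (I := 𝓘(ℝ, E)) (n := ∞) z y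
    (y := extChartAt 𝓘(ℝ, E) y m) (by simp [hy, hz])
  rwa [modelWithCornersSelf_coe, range_id, contDiffWithinAt_univ] at hchange

theorem fderiv_coordChange (y z m : M) :
    fderiv ℝ (coordChange E y z) (extChartAt 𝓘(ℝ, E) y m) = tangentCoordChange 𝓘(ℝ, E) y z m := by
  simp [coordChange]

theorem surjective_fderiv_coordChange {y z m : M} (hy : m ∈ (chartAt E y).source)
    (hz : m ∈ (chartAt E z).source) :
    Function.Surjective (fderiv ℝ (coordChange E y z) (extChartAt 𝓘(ℝ, E) y m)) := by
  have : IsManifold 𝓘(ℝ, E) 1 M := .of_le (n := ∞) (by simp)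
  intro v
  refine ⟨tangentCoordChange 𝓘(ℝ, E) z y m v, ?_⟩
  rw [fderiv_coordChange, tangentCoordChange_comp, tangentCoordChange_self]
  all_goals simp [hy, hz]

theorem contMDiffOn_mfderiv_extChartAt_symm (y : M) (u : E) :
    ContMDiffOn 𝓘(ℝ, E) 𝓘(ℝ, E).tangent ∞
      (fun p ↦ (⟨(extChartAt 𝓘(ℝ, E) y).symm p,
        mfderiv 𝓘(ℝ, E) 𝓘(ℝ, E) (extChartAt 𝓘(ℝ, E) y).symm p u⟩ : TangentBundle 𝓘(ℝ, E) M))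
      (extChartAt 𝓘(ℝ, E) y).target := by
  have htangent := (contMDiffOn_extChartAt_symm (I := 𝓘(ℝ, E)) (n := ∞)
    y).contMDiffOn_tangentMapWithin (m := ∞) (by simp) (isOpen_extChartAt_target y).uniqueMDiffOn
  have hconst : ContMDiff 𝓘(ℝ, E) 𝓘(ℝ, E).tangent ∞
      (fun p : E ↦ (⟨p, u⟩ : TangentBundle 𝓘(ℝ, E) E)) :=
    contMDiff_vectorSpace_iff_contDiff.2 contDiff_const
  refine (htangent.comp hconst.contMDiffOn fun p hp ↦ hp).congr fun p hp ↦ ?_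
  simp only [Function.comp, tangentMapWithin]
  rw [mfderivWithin_of_isOpen (isOpen_extChartAt_target y) hp]

theorem contDiffOn_localMetric [FiniteDimensional ℝ E] (g : Metric E M) (y : M) :
    ContDiffOn ℝ ∞ (localMetric g y) (extChartAt 𝓘(ℝ, E) y).target := by
  refine contDiffOn_clm_apply.2 fun u ↦ contDiffOn_clm_apply.2 fun w p hp ↦ ?_
  have happly : ContMDiffWithinAt 𝓘(ℝ, E) (𝓘(ℝ, E).prod 𝓘(ℝ)) ∞
      (fun p ↦ Bundle.TotalSpace.mk' ℝ (E := Bundle.Trivial M ℝ) ((extChartAt 𝓘(ℝ, E) y).symm p)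
        (localMetric g y p u w)) (extChartAt 𝓘(ℝ, E) y).target p :=
    ContMDiffWithinAt.clm_bundle_apply₂ (F₁ := E) (F₂ := E)
      (g.contMDiff.contMDiffAt.comp_contMDiffWithinAt p (contMDiffOn_extChartAt_symm y p hp))
      (contMDiffOn_mfderiv_extChartAt_symm y u p hp) (contMDiffOn_mfderiv_extChartAt_symm y w p hp)
  rw [Bundle.contMDiffWithinAt_totalSpace] at happly
  exact contMDiffWithinAt_iff_contDiffWithinAt.1 happly.2

theorem contDiffAt_localMetric [FiniteDimensional ℝ E] (g : Metric E M) {y : M} {p : E}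
    (hp : p ∈ (extChartAt 𝓘(ℝ, E) y).target) : ContDiffAt ℝ ∞ (localMetric g y) p :=
  (contDiffOn_localMetric g y).contDiffAt ((isOpen_extChartAt_target y).mem_nhds hp)

theorem localMetric_symm (g : Metric E M) (y : M) (p u w : E) :
    localMetric g y p u w = localMetric g y p w u :=
  g.symm ((extChartAt 𝓘(ℝ, E) y).symm p) _ _

theorem isInvertible_localMetric [FiniteDimensional ℝ E] (g : Metric E M) {y : M} {p : E}
    (hp : p ∈ (extChartAt 𝓘(ℝ, E) y).target) : (localMetric g y p).IsInvertible := by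
  have : IsManifold 𝓘(ℝ, E) 1 M := .of_le (n := ∞) (by simp)
  have hchart := isInvertible_mfderivWithin_extChartAt_symm (I := 𝓘(ℝ, E)) hp
  simp only [modelWithCornersSelf_coe, Set.range_id, mfderivWithin_univ] at hchart
  have hinj : Function.Injective (localMetric g y p) := by
    refine (injective_iff_map_eq_zero _).2 fun u hu ↦ by_contra fun hne ↦ ?_
    refine (g.pos _ (mfderiv 𝓘(ℝ, E) 𝓘(ℝ, E) (extChartAt 𝓘(ℝ, E) y).symm p u)
      fun h ↦ hne (hchart.injective (h.trans (map_zero _).symm))).ne' ?_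
    exact DFunLike.congr_fun hu u
  have hfinrank : Module.finrank ℝ E = Module.finrank ℝ (E →L[ℝ] ℝ) := by
    rw [← LinearEquiv.finrank_eq (LinearMap.toContinuousLinearMap (𝕜 := ℝ) (E := E) (F' := ℝ))]
    exact (Subspace.dual_finrank_eq (K := ℝ) (V := E)).symm
  exact ⟨(LinearEquiv.ofInjectiveOfFinrankEq (localMetric g y p).toLinearMap hinj
    hfinrank).toContinuousLinearEquiv, rfl⟩

theorem mfderiv_extChartAt_symm_eq_comp {y z m : M} (hy : m ∈ (chartAt E y).source)
    (hz : m ∈ (chartAt E z).source) :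
    (mfderiv 𝓘(ℝ, E) 𝓘(ℝ, E) (extChartAt 𝓘(ℝ, E) y).symm (extChartAt 𝓘(ℝ, E) y m) : E →L[ℝ] E) =
      (mfderiv 𝓘(ℝ, E) 𝓘(ℝ, E) (extChartAt 𝓘(ℝ, E) z).symm
        (extChartAt 𝓘(ℝ, E) z m) : E →L[ℝ] E).comp
          (fderiv ℝ (coordChange E y z) (extChartAt 𝓘(ℝ, E) y m)) := by
  have : IsManifold 𝓘(ℝ, E) 1 M := .of_le (n := ∞) (by simp)
  have hcomp : (extChartAt 𝓘(ℝ, E) y).symm =ᶠ[𝓝 (extChartAt 𝓘(ℝ, E) y m)]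
      (extChartAt 𝓘(ℝ, E) z).symm ∘ coordChange E y z := by
    refine (eventually_nhds_extChartAt_iff hy).2 ?_
    filter_upwards [(chartAt E y).open_source.mem_nhds hy, (chartAt E z).open_source.mem_nhds hz]
      with q hqy hqz
    simp [coordChange, hqy, hqz]
  have hsymm : MDifferentiableAt 𝓘(ℝ, E) 𝓘(ℝ, E) (extChartAt 𝓘(ℝ, E) z).symm
      (coordChange E y z (extChartAt 𝓘(ℝ, E) y m)) := by
    have hwithin := mdifferentiableWithinAt_extChartAt_symm (I := 𝓘(ℝ, E))
      (extChartAt_mem_target hz)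
    rwa [modelWithCornersSelf_coe, range_id, mdifferentiableWithinAt_univ,
      ← coordChange_extChartAt hy] at hwithin
  have hderiv := (hsymm.hasMFDerivAt.comp _ ((contDiffAt_coordChange hy hz).differentiableAt
    (by simp)).mdifferentiableAt.hasMFDerivAt).congr_of_eventuallyEq hcomp
  rw [mfderiv_eq_fderiv, coordChange_extChartAt hy] at hderiv
  exact hderiv.mfderiv

theorem localMetric_eventuallyEq_pullbackForm (g : Metric E M) {y z m : M}
    (hy : m ∈ (chartAt E y).source) (hz : m ∈ (chartAt E z).source) :
    localMetric g y =ᶠ[𝓝 (extChartAt 𝓘(ℝ, E) y m)]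
      pullbackForm (coordChange E y z) (localMetric g z) := by
  refine (eventually_nhds_extChartAt_iff hy).2 ?_
  filter_upwards [(chartAt E y).open_source.mem_nhds hy, (chartAt E z).open_source.mem_nhds hz]
    with q hqy hqz
  have hpoint : (extChartAt 𝓘(ℝ, E) y).symm (extChartAt 𝓘(ℝ, E) y q) =
      (extChartAt 𝓘(ℝ, E) z).symm (extChartAt 𝓘(ℝ, E) z q) := by simp [hqy, hqz]
  have hinner : ∀ {a b : M}, a = b → ∀ u w : E,
      (g.inner a : E →L[ℝ] E →L[ℝ] ℝ) u w = (g.inner b : E →L[ℝ] E →L[ℝ] ℝ) u w := by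
    rintro a _ rfl u w
    rfl
  ext u w
  rw [pullbackForm, coordChange_extChartAt hqy, localMetric, localMetric,
    mfderiv_extChartAt_symm_eq_comp hqy hqz]
  exact hinner hpoint _ _

end LocalMetric

section TangentLift

/-- The lift `t ↦ (γ t, γ' t)` of a curve to the tangent bundle. -/
def tangentLift (E : Type*) [NormedAddCommGroup E] [NormedSpace ℝ E] {M : Type*}
    [TopologicalSpace M] [ChartedSpace E M] (γ : ℝ → M) (t : ℝ) : TangentBundle 𝓘(ℝ, E) M :=
  tangentMap 𝓘(ℝ, ℝ) 𝓘(ℝ, E) γ ⟨t, (1 : ℝ)⟩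

theorem tangentLift_eq_of_hasMFDerivAt {γ : ℝ → M} {t : ℝ} {γ' : ℝ →L[ℝ] E}
    (h : HasMFDerivAt 𝓘(ℝ, ℝ) 𝓘(ℝ, E) γ t γ') : tangentLift E γ t = ⟨γ t, γ' 1⟩ :=
  congrArg (fun L : ℝ →L[ℝ] E ↦ (⟨γ t, L 1⟩ : TangentBundle 𝓘(ℝ, E) M)) h.mfderiv

theorem tangentLift_congr {γ₁ γ₂ : ℝ → M} {t : ℝ} (h : γ₁ =ᶠ[𝓝 t] γ₂) :
    tangentLift E γ₁ t = tangentLift E γ₂ t :=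
  (congrArg (fun L : ℝ →L[ℝ] E ↦ (⟨γ₁ t, L 1⟩ : TangentBundle 𝓘(ℝ, E) M)) h.mfderiv_eq).trans <|
    congrArg (fun m ↦ (⟨m, (mfderiv 𝓘(ℝ, ℝ) 𝓘(ℝ, E) γ₂ t : ℝ →L[ℝ] E) 1⟩ :
      TangentBundle 𝓘(ℝ, E) M)) h.eq_of_nhds

theorem tangentLift_const (m : M) (t : ℝ) : tangentLift E (fun _ ↦ m) t = ⟨m, (0 : E)⟩ :=
  tangentLift_eq_of_hasMFDerivAt (hasMFDerivAt_const m t)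

theorem tangentLift_comp_mul {γ : ℝ → M} {s t : ℝ}
    (hγ : MDifferentiableAt 𝓘(ℝ, ℝ) 𝓘(ℝ, E) γ (s * t)) :
    tangentLift E (fun τ ↦ γ (s * τ)) t =
      ⟨(tangentLift E γ (s * t)).proj, (s • (tangentLift E γ (s * t)).2 : E)⟩ := by
  have hmul : HasFDerivAt (fun τ : ℝ ↦ s * τ) (s • ContinuousLinearMap.id ℝ ℝ) t :=
    (hasFDerivAt_id t).const_mul s
  let L : ℝ →L[ℝ] E := mfderiv 𝓘(ℝ, ℝ) 𝓘(ℝ, E) γ (s * t)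
  exact (tangentLift_eq_of_hasMFDerivAt (hγ.hasMFDerivAt.comp t hmul.hasMFDerivAt)).trans
    (congrArg (Bundle.TotalSpace.mk (F := E) (γ (s * t))) (L.map_smul s 1))

theorem tangentLift_comp_sub {γ : ℝ → M} {r t : ℝ}
    (hγ : MDifferentiableAt 𝓘(ℝ, ℝ) 𝓘(ℝ, E) γ (t - r)) :
    tangentLift E (fun τ ↦ γ (τ - r)) t = tangentLift E γ (t - r) := by
  have htrans : HasFDerivAt (fun τ : ℝ ↦ τ - r) (ContinuousLinearMap.id ℝ ℝ) t :=
    (hasFDerivAt_id t).sub_const r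
  exact tangentLift_eq_of_hasMFDerivAt (hγ.hasMFDerivAt.comp t htrans.hasMFDerivAt)

variable [IsManifold 𝓘(ℝ, E) 1 M]

theorem mem_extChartAt_tangent_source_iff {p q : TangentBundle 𝓘(ℝ, E) M} :
    q ∈ (extChartAt 𝓘(ℝ, E).tangent p).source ↔ q.proj ∈ (chartAt E p.proj).source := by
  rw [extChartAt_source]
  exact TangentBundle.mem_chart_source_iff q p

theorem mem_extChartAt_tangent_target_iff {p : TangentBundle 𝓘(ℝ, E) M} {z : E × E} :
    z ∈ (extChartAt 𝓘(ℝ, E).tangent p).target ↔ z.1 ∈ (extChartAt 𝓘(ℝ, E) p.proj).target := by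
  rw [FiberBundle.extChartAt_target, mem_prod, and_iff_left (mem_univ _), mem_inter_iff,
    and_iff_left_iff_imp]
  intro hz
  simpa using (extChartAt 𝓘(ℝ, E) p.proj).map_target hz

theorem extChartAt_tangentLift {p : TangentBundle 𝓘(ℝ, E) M} {γ : ℝ → M} {t : ℝ}
    (hγ : MDifferentiableAt 𝓘(ℝ, ℝ) 𝓘(ℝ, E) γ t) (ht : γ t ∈ (chartAt E p.proj).source) :
    extChartAt 𝓘(ℝ, E).tangent p (tangentLift E γ t) =
      (extChartAt 𝓘(ℝ, E) p.proj (γ t), deriv (extChartAt 𝓘(ℝ, E) p.proj ∘ γ) t) := by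
  let A : E →L[ℝ] E := mfderiv 𝓘(ℝ, E) 𝓘(ℝ, E) (extChartAt 𝓘(ℝ, E) p.proj) (γ t)
  let L : ℝ →L[ℝ] E := mfderiv 𝓘(ℝ, ℝ) 𝓘(ℝ, E) γ t
  have hcomp : HasFDerivAt (extChartAt 𝓘(ℝ, E) p.proj ∘ γ) (A ∘L L) t :=
    ((mdifferentiableAt_extChartAt ht).hasMFDerivAt.comp t hγ.hasMFDerivAt).hasFDerivAt
  let e := trivializationAt E (TangentSpace 𝓘(ℝ, E)) p.proj
  have hbase : γ t ∈ e.baseSet := ht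
  have hsnd : (e (tangentLift E γ t)).2 = A (L 1) :=
    (congrFun (e.coe_linearMapAt_of_mem (R := ℝ) hbase) (L 1)).symm.trans
      (DFunLike.congr_fun (TangentBundle.continuousLinearMapAt_trivializationAt ht) (L 1))
  rw [hcomp.hasDerivAt.deriv, FiberBundle.extChartAt]
  exact Prod.ext rfl hsnd

theorem continuousOn_tangentLift {γ : ℝ → M} {s : Set ℝ} (hs : IsOpen s)
    (hγ : ContMDiffOn 𝓘(ℝ, ℝ) 𝓘(ℝ, E) 1 γ s) : ContinuousOn (tangentLift E γ) s := by
  have hlift : Continuous fun t : ℝ ↦ (⟨t, (1 : ℝ)⟩ : TangentBundle 𝓘(ℝ, ℝ) ℝ) :=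
    (contMDiff_vectorSpace_iff_contDiff (n := 0).2 contDiff_const).continuous
  refine ((hγ.continuousOn_tangentMapWithin le_rfl hs.uniqueMDiffOn).comp hlift.continuousOn
    fun t ht ↦ ht).congr fun t ht ↦ ?_
  simp only [tangentLift, tangentMap, tangentMapWithin, Function.comp,
    mfderivWithin_of_isOpen hs ht]

end TangentLift

section Geodesics

variable [IsManifold 𝓘(ℝ, E) ∞ M]

theorem contDiffAt_extChartAt_comp {γ : ℝ → M} {t : ℝ} {y : M}
    (hγ : ContMDiffAt 𝓘(ℝ, ℝ) 𝓘(ℝ, E) 2 γ t) (hy : γ t ∈ (chartAt E y).source) :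
    ContDiffAt ℝ 2 (extChartAt 𝓘(ℝ, E) y ∘ γ) t :=
  (((contMDiffAt_extChartAt' (n := ∞) hy).of_le
    (WithTop.coe_le_coe.2 (le_top : (2 : ℕ∞) ≤ ⊤))).comp t hγ).contDiffAt

theorem christoffelForm_localMetric (g : Metric E M) (y : M) (p v w : E) :
    christoffelForm (localMetric g y) (p, v) w = christoffel g y p v v w := by
  rw [christoffelForm_apply, christoffel]
  ring

variable {g : Metric E M} {γ γ₁ γ₂ : ℝ → M} {s s₁ s₂ : Set ℝ} {t : ℝ} {y : M}

theorem IsGeodesicOn.contMDiffAt (h : IsGeodesicOn g γ s) (hs : s ∈ 𝓝 t) :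
    ContMDiffAt 𝓘(ℝ, ℝ) 𝓘(ℝ, E) 2 γ t :=
  h.contMDiffOn.contMDiffAt hs

theorem IsGeodesicOn.mdifferentiableAt (h : IsGeodesicOn g γ s) (hs : s ∈ 𝓝 t) :
    MDifferentiableAt 𝓘(ℝ, ℝ) 𝓘(ℝ, E) γ t :=
  (h.contMDiffAt hs).mdifferentiableAt (by simp)

theorem IsGeodesicOn.geodesicEquationAt (h : IsGeodesicOn g γ s) (ht : t ∈ s)
    (hy : γ t ∈ (chartAt E y).source) :
    GeodesicEquationAt (localMetric g y) (extChartAt 𝓘(ℝ, E) y ∘ γ) t :=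
  ContinuousLinearMap.ext fun w ↦ by
    rw [add_apply, christoffelForm_localMetric]
    exact h.equation t ht y hy w

theorem IsGeodesicOn.mono (h : IsGeodesicOn g γ s₁) (hs : s₂ ⊆ s₁) : IsGeodesicOn g γ s₂ :=
  ⟨h.contMDiffOn.mono hs, fun t ht ↦ h.equation t (hs ht)⟩

theorem IsGeodesicOn.union (h₁ : IsGeodesicOn g γ s₁) (h₂ : IsGeodesicOn g γ s₂)
    (hs₁ : IsOpen s₁) (hs₂ : IsOpen s₂) : IsGeodesicOn g γ (s₁ ∪ s₂) :=
  ⟨h₁.contMDiffOn.union_of_isOpen h₂.contMDiffOn hs₁ hs₂,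
    fun t ht ↦ ht.elim (h₁.equation t) (h₂.equation t)⟩

theorem IsGeodesicOn.continuousOn_tangentLift (h : IsGeodesicOn g γ s) (hs : IsOpen s) :
    ContinuousOn (tangentLift E γ) s :=
  have : IsManifold 𝓘(ℝ, E) 1 M := .of_le (n := ∞) (by simp)
  RiemannianExp.continuousOn_tangentLift hs (h.contMDiffOn.of_le (by norm_num))

theorem IsGeodesicOn.tangentLift_comp_sub {r : ℝ} (h : IsGeodesicOn g γ s) (hs : IsOpen s)
    (ht : t - r ∈ s) : tangentLift E (fun τ ↦ γ (τ - r)) t = tangentLift E γ (t - r) :=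
  RiemannianExp.tangentLift_comp_sub (h.mdifferentiableAt (hs.mem_nhds ht))

variable [FiniteDimensional ℝ E]

theorem isGeodesicOn_of_geodesicEquationAt (hs : IsOpen s)
    (hγ : ContMDiffOn 𝓘(ℝ, ℝ) 𝓘(ℝ, E) 2 γ s)
    (h : ∀ t ∈ s, ∃ y, γ t ∈ (chartAt E y).source ∧
      GeodesicEquationAt (localMetric g y) (extChartAt 𝓘(ℝ, E) y ∘ γ) t) :
    IsGeodesicOn g γ s := by
  refine ⟨hγ, fun t ht z hz w ↦ ?_⟩
  obtain ⟨y, hy, heq⟩ := h t ht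
  have hγt := hγ.contMDiffAt (hs.mem_nhds ht)
  have htransfer : GeodesicEquationAt (localMetric g z)
      (coordChange E y z ∘ extChartAt 𝓘(ℝ, E) y ∘ γ) t :=
    heq.comp (contDiffAt_extChartAt_comp hγt hy)
      ((contDiffAt_coordChange hy hz).of_le (WithTop.coe_le_coe.2 (le_top : (2 : ℕ∞) ≤ ⊤)))
      (surjective_fderiv_coordChange hy hz)
      ((contDiffAt_localMetric g (extChartAt_mem_target hy)).differentiableAt (by simp))
      (by
        rw [Function.comp_apply, coordChange_extChartAt hy]
        exact (contDiffAt_localMetric g (extChartAt_mem_target hz)).differentiableAt (by simp))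
      (fun u w ↦ localMetric_symm g z _ u w) (localMetric_eventuallyEq_pullbackForm g hy hz)
  have hz_eq : extChartAt 𝓘(ℝ, E) z ∘ γ =ᶠ[𝓝 t] coordChange E y z ∘ extChartAt 𝓘(ℝ, E) y ∘ γ :=
    hγt.continuousAt.eventually (extChartAt_eventuallyEq_coordChange_comp hy)
  have := DFunLike.congr_fun (htransfer.congr_of_eventuallyEq hz_eq) w
  rwa [add_apply, christoffelForm_localMetric] at this

theorem IsGeodesicOn.congr (h : IsGeodesicOn g γ₁ s) (hs : IsOpen s) (heq : EqOn γ₂ γ₁ s) :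
    IsGeodesicOn g γ₂ s := by
  refine isGeodesicOn_of_geodesicEquationAt hs (h.contMDiffOn.congr heq) fun t ht ↦
    ⟨γ₁ t, heq ht ▸ mem_chart_source E _,
      (h.geodesicEquationAt ht (mem_chart_source E _)).congr_of_eventuallyEq ?_⟩
  exact (heq.eventuallyEq_of_mem (hs.mem_nhds ht)).fun_comp _

theorem IsGeodesicOn.comp_mul_add {a r : ℝ} (h : IsGeodesicOn g γ s₁) (hs : IsOpen s₂)
    (hmaps : MapsTo (fun τ ↦ a * τ + r) s₂ s₁) :
    IsGeodesicOn g (fun τ ↦ γ (a * τ + r)) s₂ := by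
  have haffine : ContDiff ℝ 2 fun τ : ℝ ↦ a * τ + r := by fun_prop
  exact isGeodesicOn_of_geodesicEquationAt hs
    (h.contMDiffOn.comp haffine.contMDiff.contMDiffOn hmaps) fun t ht ↦
    ⟨γ (a * t + r), mem_chart_source E _,
      (h.geodesicEquationAt (hmaps ht) (mem_chart_source E _)).comp_mul_add⟩

theorem IsGeodesicOn.hasDerivAt_extChartAt_tangentLift {p : TangentBundle 𝓘(ℝ, E) M}
    (h : IsGeodesicOn g γ s) (hs : IsOpen s) (ht : t ∈ s)
    (hp : γ t ∈ (chartAt E p.proj).source) :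
    HasDerivAt (fun τ ↦ extChartAt 𝓘(ℝ, E).tangent p (tangentLift E γ τ))
      (spray (localMetric g p.proj) (extChartAt 𝓘(ℝ, E).tangent p (tangentLift E γ t))) t := by
  have : IsManifold 𝓘(ℝ, E) 1 M := .of_le (n := ∞) (by simp)
  have hlift : ∀ᶠ τ in 𝓝 t, extChartAt 𝓘(ℝ, E).tangent p (tangentLift E γ τ) =
      (extChartAt 𝓘(ℝ, E) p.proj (γ τ), deriv (extChartAt 𝓘(ℝ, E) p.proj ∘ γ) τ) := by
    filter_upwards [hs.mem_nhds ht, (h.contMDiffAt (hs.mem_nhds ht)).continuousAt.eventually_mem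
      ((chartAt E p.proj).open_source.mem_nhds hp)] with τ hτ hsource
    exact extChartAt_tangentLift (h.mdifferentiableAt (hs.mem_nhds hτ)) hsource
  rw [hlift.self_of_nhds]
  refine HasDerivAt.congr_of_eventuallyEq ?_ hlift
  exact (h.geodesicEquationAt ht hp).hasDerivAt_prodMk_deriv
    (contDiffAt_extChartAt_comp (h.contMDiffAt (hs.mem_nhds ht)) hp)
    (isInvertible_localMetric g (extChartAt_mem_target hp))

theorem isGeodesicOn_of_hasDerivAt_spray {q : ℝ → E × E} (hs : IsOpen s)
    (hmem : ∀ t ∈ s, (q t).1 ∈ (extChartAt 𝓘(ℝ, E) y).target)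
    (hq : ∀ t ∈ s, HasDerivAt q (spray (localMetric g y) (q t)) t) :
    IsGeodesicOn g (fun t ↦ (extChartAt 𝓘(ℝ, E) y).symm (q t).1) s := by
  have hsource : ∀ t ∈ s, (extChartAt 𝓘(ℝ, E) y).symm (q t).1 ∈ (chartAt E y).source :=
    fun t ht ↦ by
      simpa only [extChartAt_source] using (extChartAt 𝓘(ℝ, E) y).map_target (hmem t ht)
  have hinv := fun t ht ↦ isInvertible_localMetric g (hmem t ht)
  have hC2 : ContDiffOn ℝ 2 (fun t ↦ (q t).1) s := contDiffOn_fst_of_hasDerivAt_spray hs hq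
    (fun t ht ↦ (contDiffAt_localMetric g (hmem t ht)).of_le (by simp)) hinv
  refine isGeodesicOn_of_geodesicEquationAt hs
    (((contMDiffOn_extChartAt_symm (n := ∞) y).of_le
      (WithTop.coe_le_coe.2 (le_top : (2 : ℕ∞) ≤ ⊤))).comp hC2.contMDiffOn hmem)
    fun t ht ↦ ⟨y, hsource t ht, ?_⟩
  exact (geodesicEquationAt_fst_of_hasDerivAt_spray
    (Filter.eventually_of_mem (hs.mem_nhds ht) hq) (hinv t ht)).congr_of_eventuallyEq
      (Filter.eventuallyEq_of_mem (hs.mem_nhds ht)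
        fun τ hτ ↦ (extChartAt 𝓘(ℝ, E) y).right_inv (hmem τ hτ))

theorem tangentLift_of_hasDerivAt_spray {p : TangentBundle 𝓘(ℝ, E) M} {q : ℝ → E × E}
    (hs : IsOpen s) (hmem : ∀ t ∈ s, (q t).1 ∈ (extChartAt 𝓘(ℝ, E) p.proj).target)
    (hq : ∀ t ∈ s, HasDerivAt q (spray (localMetric g p.proj) (q t)) t) (ht : t ∈ s) :
    tangentLift E (fun t ↦ (extChartAt 𝓘(ℝ, E) p.proj).symm (q t).1) t =
      (extChartAt 𝓘(ℝ, E).tangent p).symm (q t) := by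
  have : IsManifold 𝓘(ℝ, E) 1 M := .of_le (n := ∞) (by simp)
  have hgeodesic := isGeodesicOn_of_hasDerivAt_spray hs hmem hq
  have hsource : (extChartAt 𝓘(ℝ, E) p.proj).symm (q t).1 ∈ (chartAt E p.proj).source := by
    simpa only [extChartAt_source] using (extChartAt 𝓘(ℝ, E) p.proj).map_target (hmem t ht)
  have hfst : EqOn (extChartAt 𝓘(ℝ, E) p.proj ∘ fun t ↦ (extChartAt 𝓘(ℝ, E) p.proj).symm (q t).1)
      (fun t ↦ (q t).1) s := fun τ hτ ↦ (extChartAt 𝓘(ℝ, E) p.proj).right_inv (hmem τ hτ)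
  rw [PartialEquiv.eq_symm_apply]
  · rw [extChartAt_tangentLift (hgeodesic.mdifferentiableAt (hs.mem_nhds ht)) hsource,
      (hfst.eventuallyEq_of_mem (hs.mem_nhds ht)).deriv_eq,
      (hasDerivAt_fst_of_hasDerivAt_spray (hq t ht)).deriv]
    exact Prod.ext (hfst ht) rfl
  · exact mem_extChartAt_tangent_source_iff.2 hsource
  · exact mem_extChartAt_tangent_target_iff.2 (hmem t ht)

end Geodesics

section Uniqueness

variable [FiniteDimensional ℝ E] [IsManifold 𝓘(ℝ, E) ∞ M]
  {g : Metric E M} {γ γ₁ γ₂ : ℝ → M} {s : Set ℝ} {t t' : ℝ}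

theorem contDiffAt_spray_localMetric (g : Metric E M) {y : M} {z : E × E}
    (hz : z.1 ∈ (extChartAt 𝓘(ℝ, E) y).target) :
    ContDiffAt ℝ ∞ (spray (localMetric g y)) z :=
  contDiffAt_spray (n := ∞) (contDiffAt_localMetric g hz) (isInvertible_localMetric g hz)

theorem IsGeodesicOn.tangentLift_eventuallyEq (h₁ : IsGeodesicOn g γ₁ s)
    (h₂ : IsGeodesicOn g γ₂ s) (hs : IsOpen s) (ht : t ∈ s)
    (heq : tangentLift E γ₁ t = tangentLift E γ₂ t) :
    tangentLift E γ₁ =ᶠ[𝓝 t] tangentLift E γ₂ := by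
  have : IsManifold 𝓘(ℝ, E) 1 M := .of_le (n := ∞) (by simp)
  let p := tangentLift E γ₁ t
  let φ := extChartAt 𝓘(ℝ, E).tangent p
  obtain ⟨K, V, hV, hK⟩ := ((contDiffAt_spray_localMetric g (z := φ p)
    (mem_extChartAt_target p.proj)).of_le (m := 1) (by simp)).exists_lipschitzOnWith
  have hint : ∀ {γ : ℝ → M}, IsGeodesicOn g γ s → tangentLift E γ t = p → ∀ᶠ τ in 𝓝 t,
      tangentLift E γ τ ∈ φ.source ∧ HasDerivAt (fun τ ↦ φ (tangentLift E γ τ))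
        (spray (localMetric g p.proj) (φ (tangentLift E γ τ))) τ ∧
        φ (tangentLift E γ τ) ∈ V := by
    intro γ h hp
    have hcont : ContinuousAt (tangentLift E γ) t :=
      (h.continuousOn_tangentLift hs).continuousAt (hs.mem_nhds ht)
    rw [ContinuousAt, hp] at hcont
    filter_upwards [hs.mem_nhds ht, hcont (extChartAt_source_mem_nhds (I := 𝓘(ℝ, E).tangent) p),
      hcont ((continuousAt_extChartAt (I := 𝓘(ℝ, E).tangent) p).preimage_mem_nhds hV)]
      with τ hτ hsource hτV
    exact ⟨hsource, h.hasDerivAt_extChartAt_tangentLift hs hτ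
      (mem_extChartAt_tangent_source_iff.1 hsource), hτV⟩
  have hint₁ := hint h₁ rfl
  have hint₂ := hint h₂ heq.symm
  have hunique := ODE_solution_unique_of_eventually
    (v := fun _ ↦ spray (localMetric g p.proj)) (Filter.Eventually.of_forall fun _ ↦ hK)
    (hint₁.mono fun _ ↦ And.right) (hint₂.mono fun _ ↦ And.right) (congrArg φ heq)
  filter_upwards [hunique, hint₁, hint₂] with τ hτ hτ₁ hτ₂ using φ.injOn hτ₁.1 hτ₂.1 hτ

theorem IsGeodesicOn.eqOn_tangentLift [T2Space M] (h₁ : IsGeodesicOn g γ₁ s)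
    (h₂ : IsGeodesicOn g γ₂ s) (hs : IsOpen s) (hconn : IsPreconnected s) (ht : t ∈ s)
    (heq : tangentLift E γ₁ t = tangentLift E γ₂ t) :
    EqOn (tangentLift E γ₁) (tangentLift E γ₂) s := by
  have : T2Space (TangentBundle 𝓘(ℝ, E) M) := t2Space_totalSpace
  let u := {τ | τ ∈ s ∧ tangentLift E γ₁ τ = tangentLift E γ₂ τ}
  have hu : IsOpen u := isOpen_iff_mem_nhds.2 fun τ hτ ↦
    (hs.eventually_mem hτ.1).and (h₁.tangentLift_eventuallyEq h₂ hs hτ.1 hτ.2)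
  have hclosed : closure u ∩ s ⊆ u := fun τ hτ ↦ by
    have hcont : ∀ {γ : ℝ → M}, IsGeodesicOn g γ s → ContinuousAt (tangentLift E γ) τ :=
      fun h ↦ (h.continuousOn_tangentLift hs).continuousAt (hs.mem_nhds hτ.2)
    exact ⟨hτ.2, tendsto_nhds_unique_of_frequently_eq (hcont h₁) (hcont h₂)
      ((mem_closure_iff_frequently.1 hτ.1).mono fun _ ↦ And.right)⟩
  exact fun τ hτ ↦ (hconn.subset_of_closure_inter_subset hu ⟨t, ht, ht, heq⟩ hclosed hτ).2

theorem IsGeodesicOn.comp_sub {a b r : ℝ} (h : IsGeodesicOn g γ (Ioo a b)) :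
    IsGeodesicOn g (fun τ ↦ γ (τ - r)) (Ioo (a + r) (b + r)) := by
  simpa only [one_mul, ← sub_eq_add_neg] using h.comp_mul_add (a := 1) (r := -r) isOpen_Ioo
    fun τ hτ ↦ ⟨by linarith [hτ.1], by linarith [hτ.2]⟩

theorem eqOn_piecewise_of_eqOn_inter {α β : Type*} {s t : Set α} [DecidablePred (· ∈ s)]
    {f₁ f₂ : α → β} (h : EqOn f₁ f₂ (s ∩ t)) : EqOn (s.piecewise f₁ f₂) f₂ t := fun x hx ↦ by
  by_cases hxs : x ∈ s
  · rw [piecewise_eq_of_mem _ _ _ hxs, h ⟨hxs, hx⟩]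
  · rw [piecewise_eq_of_notMem _ _ _ hxs]

theorem IsGeodesicOn.piecewise {I J : Set ℝ} [DecidablePred (· ∈ I)] (h₁ : IsGeodesicOn g γ₁ I)
    (h₂ : IsGeodesicOn g γ₂ J) (hI : IsOpen I) (hJ : IsOpen J) (heq : EqOn γ₁ γ₂ (I ∩ J)) :
    IsGeodesicOn g (I.piecewise γ₁ γ₂) (I ∪ J) :=
  (h₁.congr hI (piecewise_eqOn I γ₁ γ₂)).union (h₂.congr hJ (eqOn_piecewise_of_eqOn_inter heq))
    hI hJ

theorem isGeodesicOn_const (g : Metric E M) (hs : IsOpen s) (m : M) :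
    IsGeodesicOn g (fun _ ↦ m) s :=
  isGeodesicOn_of_geodesicEquationAt hs contMDiffOn_const fun _ _ ↦
    ⟨m, mem_chart_source E m, ContinuousLinearMap.ext fun w ↦ by
      simp [Function.comp_def, christoffelForm_apply]⟩

theorem IsGeodesicOn.tangentLift_snd_eq_zero [T2Space M] (h : IsGeodesicOn g γ s)
    (hs : IsOpen s) (hconn : IsPreconnected s) (ht : t ∈ s) (ht' : t' ∈ s)
    (hzero : (tangentLift E γ t).2 = 0) : (tangentLift E γ t').2 = 0 := by
  have heq : tangentLift E γ t = tangentLift E (fun _ ↦ γ t) t := by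
    rw [tangentLift_const]
    exact congrArg (Bundle.TotalSpace.mk (γ t)) hzero
  rw [h.eqOn_tangentLift (isGeodesicOn_const g hs (γ t)) hs hconn ht heq ht', tangentLift_const]
  rfl

end Uniqueness

section Flow

variable [FiniteDimensional ℝ E] [IsManifold 𝓘(ℝ, E) ∞ M]

/-- A family of geodesics `Γ p` on the times `I`, indexed by an open set `U` of initial conditions
`p = (Γ p 0, (Γ p)' 0)`, whose position and velocity at each time of `I` depend differentiably
on `p`. -/
structure IsGeodesicFlowOn (g : Metric E M) (Γ : TangentBundle 𝓘(ℝ, E) M → ℝ → M)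
    (U : Set (TangentBundle 𝓘(ℝ, E) M)) (I : Set ℝ) : Prop where
  isOpen : IsOpen U
  isGeodesicOn : ∀ p ∈ U, IsGeodesicOn g (Γ p) I
  tangentLift_zero : ∀ p ∈ U, tangentLift E (Γ p) 0 = p
  mdifferentiableAt : ∀ p ∈ U, ∀ t ∈ I,
    MDifferentiableAt 𝓘(ℝ, E).tangent 𝓘(ℝ, E).tangent (fun q ↦ tangentLift E (Γ q) t) p

variable {g : Metric E M}

theorem exists_isGeodesicFlowOn (g : Metric E M) (p : TangentBundle 𝓘(ℝ, E) M) :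
    ∃ ε > 0, ∃ U ∈ 𝓝 p, ∃ Γ, IsGeodesicFlowOn g Γ U (Ioo (-ε) ε) := by
  have : IsManifold 𝓘(ℝ, E) 1 M := .of_le (n := ∞) (by simp)
  let φ := extChartAt 𝓘(ℝ, E).tangent p
  have htarget : φ.target ∈ 𝓝 (φ p) := extChartAt_target_mem_nhds p
  obtain ⟨ε, hε, Φ, hΦ⟩ := exists_localFlow_differentiableAt
    ((contDiffAt_spray_localMetric g (z := φ p) (mem_extChartAt_target p.proj)).of_le
      (WithTop.coe_le_coe.2 (le_top : (2 : ℕ∞) ≤ ⊤))) htarget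
  let U := φ.source ∩ φ ⁻¹' ball (φ p) ε
  have hU : IsOpen U := isOpen_extChartAt_preimage' p isOpen_ball
  have hpU : p ∈ U := ⟨mem_extChartAt_source p, mem_ball_self hε⟩
  let Γ : TangentBundle 𝓘(ℝ, E) M → ℝ → M := fun q τ ↦
    (extChartAt 𝓘(ℝ, E) p.proj).symm (Φ (φ q) τ).1
  have hmem : ∀ q ∈ U, ∀ t ∈ Ioo (-ε) ε, (Φ (φ q) t).1 ∈ (extChartAt 𝓘(ℝ, E) p.proj).target :=
    fun q hq t ht ↦ mem_extChartAt_tangent_target_iff.1 ((hΦ _ hq.2).2 t ht).1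
  have hspray := fun q (hq : q ∈ U) t ht ↦ ((hΦ _ hq.2).2 t ht).2.1
  have hlift : ∀ q ∈ U, ∀ t ∈ Ioo (-ε) ε, tangentLift E (Γ q) t = φ.symm (Φ (φ q) t) :=
    fun q hq t ht ↦ tangentLift_of_hasDerivAt_spray isOpen_Ioo (hmem q hq) (hspray q hq) ht
  refine ⟨ε, hε, U, hU.mem_nhds hpU, Γ, hU,
    fun q hq ↦ isGeodesicOn_of_hasDerivAt_spray isOpen_Ioo (hmem q hq) (hspray q hq),
    fun q hq ↦ ?_, fun q hq t ht ↦ ?_⟩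
  · rw [hlift q hq 0 (by simpa using hε), (hΦ _ hq.2).1, φ.left_inv hq.1]
  · have hgerm : (fun q ↦ tangentLift E (Γ q) t) =ᶠ[𝓝 q] fun q ↦ φ.symm (Φ (φ q) t) :=
      Filter.eventually_of_mem (hU.mem_nhds hq) fun q' hq' ↦ hlift q' hq' t ht
    refine MDifferentiableAt.congr_of_eventuallyEq ?_ hgerm
    have hφ : MDifferentiableAt 𝓘(ℝ, E).tangent 𝓘(ℝ, E × E) φ q :=
      mdifferentiableAt_extChartAt (extChartAt_source 𝓘(ℝ, E).tangent p ▸ hq.1)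
    have hφsymm : MDifferentiableAt 𝓘(ℝ, E × E) 𝓘(ℝ, E).tangent φ.symm (Φ (φ q) t) :=
      (mdifferentiableWithinAt_extChartAt_symm ((hΦ _ hq.2).2 t ht).1).mdifferentiableAt
        (by simp)
    exact hφsymm.comp q (((hΦ _ hq.2).2 t ht).2.2.mdifferentiableAt.comp q hφ)

theorem IsGeodesicFlowOn.tangentLift_sub_eq [T2Space M]
    {Γ : TangentBundle 𝓘(ℝ, E) M → ℝ → M} {U : Set (TangentBundle 𝓘(ℝ, E) M)} {γ : ℝ → M}
    {a b c d t t' : ℝ} (hΓ : IsGeodesicFlowOn g Γ U (Ioo c d)) (h₀ : 0 ∈ Ioo c d)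
    (hγ : IsGeodesicOn g γ (Ioo a b)) (ht : t ∈ Ioo a b) (hU : tangentLift E γ t ∈ U)
    (ht' : t' ∈ Ioo a b) (hsub : t' - t ∈ Ioo c d) :
    tangentLift E (Γ (tangentLift E γ t)) (t' - t) = tangentLift E γ t' := by
  have hΓt := hΓ.isGeodesicOn _ hU
  have htt : t - t ∈ Ioo c d := by rwa [sub_self]
  rw [← hΓt.tangentLift_comp_sub isOpen_Ioo hsub]
  refine (hΓt.comp_sub.mono inter_subset_left).eqOn_tangentLift (hγ.mono inter_subset_right)
    (isOpen_Ioo.inter isOpen_Ioo) (ordConnected_Ioo.inter ordConnected_Ioo).isPreconnected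
    ⟨sub_mem_Ioo_iff_left.1 htt, ht⟩ ?_ ⟨sub_mem_Ioo_iff_left.1 hsub, ht'⟩
  rw [hΓt.tangentLift_comp_sub isOpen_Ioo htt, sub_self, hΓ.tangentLift_zero _ hU]

theorem IsGeodesicFlowOn.extend [T2Space M] {Γ Ψ : TangentBundle 𝓘(ℝ, E) M → ℝ → M}
    {U V : Set (TangentBundle 𝓘(ℝ, E) M)} {a b c d T : ℝ}
    (hΓ : IsGeodesicFlowOn g Γ U (Ioo a b)) (hΨ : IsGeodesicFlowOn g Ψ V (Ioo c d))
    (h₀ : 0 ∈ Ioo a b) (hT : T ∈ Ioo a b) (hcd : 0 ∈ Ioo c d) :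
    IsGeodesicFlowOn g
      (fun q ↦ (Ioo a b).piecewise (Γ q) fun τ ↦ Ψ (tangentLift E (Γ q) T) (τ - T))
      (U ∩ (fun q ↦ tangentLift E (Γ q) T) ⁻¹' V) (Ioo a b ∪ Ioo (c + T) (d + T)) := by
  have hopen : IsOpen (U ∩ (fun q ↦ tangentLift E (Γ q) T) ⁻¹' V) :=
    ContinuousOn.isOpen_inter_preimage
      (fun q hq ↦ (hΓ.mdifferentiableAt q hq T hT).continuousAt.continuousWithinAt)
      hΓ.isOpen hΨ.isOpen
  let σ : TangentBundle 𝓘(ℝ, E) M → ℝ → M := fun q τ ↦ Ψ (tangentLift E (Γ q) T) (τ - T)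
  have heq : ∀ q ∈ U, tangentLift E (Γ q) T ∈ V →
      EqOn (Γ q) (σ q) (Ioo a b ∩ Ioo (c + T) (d + T)) := fun q hqU hqV τ hτ ↦
    congrArg Bundle.TotalSpace.proj (hΨ.tangentLift_sub_eq hcd (hΓ.isGeodesicOn q hqU) hT hqV hτ.1
      (sub_mem_Ioo_iff_left.2 hτ.2)).symm
  have hleft : ∀ q, ∀ τ ∈ Ioo a b,
      tangentLift E ((Ioo a b).piecewise (Γ q) (σ q)) τ = tangentLift E (Γ q) τ := fun q τ hτ ↦
    tangentLift_congr ((piecewise_eqOn _ _ _).eventuallyEq_of_mem (isOpen_Ioo.mem_nhds hτ))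
  refine ⟨hopen, fun q hq ↦ (hΓ.isGeodesicOn q hq.1).piecewise (hΨ.isGeodesicOn _ hq.2).comp_sub
    isOpen_Ioo isOpen_Ioo (heq q hq.1 hq.2),
    fun q hq ↦ (hleft q 0 h₀).trans (hΓ.tangentLift_zero q hq.1), fun q hq τ hτ ↦ ?_⟩
  rcases hτ with hτ | hτ
  · exact (hΓ.mdifferentiableAt q hq.1 τ hτ).congr_of_eventuallyEq (.of_forall fun q ↦ hleft q τ hτ)
  · have hτT : τ - T ∈ Ioo c d := sub_mem_Ioo_iff_left.2 hτ
    have hright : (fun q ↦ tangentLift E ((Ioo a b).piecewise (Γ q) (σ q)) τ) =ᶠ[𝓝 q]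
        (fun p ↦ tangentLift E (Ψ p) (τ - T)) ∘ fun q ↦ tangentLift E (Γ q) T :=
      Filter.eventually_of_mem (hopen.mem_nhds hq) fun q hq ↦
        (tangentLift_congr ((eqOn_piecewise_of_eqOn_inter (heq q hq.1 hq.2)).eventuallyEq_of_mem
          (isOpen_Ioo.mem_nhds hτ))).trans
            ((hΨ.isGeodesicOn _ hq.2).tangentLift_comp_sub isOpen_Ioo hτT)
    exact ((hΨ.mdifferentiableAt _ hq.2 _ hτT).comp q
      (hΓ.mdifferentiableAt q hq.1 T hT)).congr_of_eventuallyEq hright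

theorem IsGeodesicOn.exists_isGeodesicFlowOn [T2Space M] {γ : ℝ → M} {a b t t' : ℝ}
    (h : IsGeodesicOn g γ (Ioo a b)) (ht : t ∈ Ioo a b) (ht' : t' ∈ Ioo a b) :
    ∃ U ∈ 𝓝 (tangentLift E γ t), ∃ c d Γ, 0 ∈ Ioo c d ∧ t' - t ∈ Ioo c d ∧
      IsGeodesicFlowOn g Γ U (Ioo c d) := by
  refine isPreconnected_Ioo.induction₂' (fun t t' ↦ ∃ U ∈ 𝓝 (tangentLift E γ t), ∃ c d Γ,
    0 ∈ Ioo c d ∧ t' - t ∈ Ioo c d ∧ IsGeodesicFlowOn g Γ U (Ioo c d)) ?_ ?_ ht ht'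
  · intro t ht
    obtain ⟨ε, hε, U, hU, Γ, hΓ⟩ := RiemannianExp.exists_isGeodesicFlowOn g (tangentLift E γ t)
    have h₀ : 0 ∈ Ioo (-ε) ε := ⟨neg_lt_zero.2 hε, hε⟩
    have hcont : ContinuousAt (tangentLift E γ) t :=
      (h.continuousOn_tangentLift isOpen_Ioo).continuousAt (isOpen_Ioo.mem_nhds ht)
    refine Filter.Eventually.filter_mono nhdsWithin_le_nhds ?_
    filter_upwards [hcont hU, ball_mem_nhds t hε] with t' hU' hdist
    rw [Real.ball_eq_Ioo] at hdist
    exact ⟨⟨U, hU, _, _, Γ, h₀, ⟨by linarith [hdist.1], by linarith [hdist.2]⟩, hΓ⟩,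
      U, hΓ.isOpen.mem_nhds hU', _, _, Γ, h₀, ⟨by linarith [hdist.2], by linarith [hdist.1]⟩, hΓ⟩
  · rintro t₁ t₂ t₃ ht₁ ht₂ - ⟨U, hU, a₁, b₁, Γ, h₀Γ, hΓT, hΓ⟩ ⟨V, hV, c, d, Ψ, h₀Ψ, hΨT, hΨ⟩
    have hUV := hΓ.extend hΨ h₀Γ hΓT h₀Ψ
    rw [Ioo_union_Ioo' (by linarith [hΓT.2, h₀Ψ.1]) (by linarith [hΓT.1, h₀Ψ.2])] at hUV
    refine ⟨_, hUV.isOpen.mem_nhds ⟨mem_of_mem_nhds hU, ?_⟩, _, _, _, ?_, ?_, hUV⟩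
    · rw [mem_preimage, hΓ.tangentLift_sub_eq h₀Γ h ht₁ (mem_of_mem_nhds hU) ht₂ hΓT]
      exact mem_of_mem_nhds hV
    · exact ⟨min_lt_of_left_lt h₀Γ.1, lt_max_of_lt_left h₀Γ.2⟩
    · exact ⟨min_lt_of_right_lt (by linarith [hΨT.1]), lt_max_of_lt_right (by linarith [hΨT.2])⟩

end Flow

section ExponentialMap

variable [IsManifold 𝓘(ℝ, E) ∞ M] {g : Metric E M} {x : M} {v : E} {γ : ℝ → M} {a b s : ℝ}

theorem mdifferentiable_totalSpaceMk (x : M) : MDifferentiable 𝓘(ℝ, E) 𝓘(ℝ, E).tangent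
    fun w : E ↦ (⟨x, w⟩ : TangentBundle 𝓘(ℝ, E) M) := by
  have : IsManifold 𝓘(ℝ, E) 1 M := .of_le (n := ∞) (by simp)
  refine fun w ↦ (mdifferentiableAt_totalSpace _ _).2 ⟨mdifferentiableAt_const, ?_⟩
  let e := trivializationAt E (TangentSpace 𝓘(ℝ, E)) x
  let L : E →L[ℝ] E := e.continuousLinearMapAt ℝ x
  have hL : (fun w : E ↦ (e ⟨x, w⟩).2) = L :=
    (e.coe_linearMapAt_of_mem (R := ℝ) (FiberBundle.mem_baseSet_trivializationAt' x)).symm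
  exact hL ▸ L.mdifferentiableAt

theorem IsGeodesicFlowOn.isUnitGeodesicFrom {Γ : TangentBundle 𝓘(ℝ, E) M → ℝ → M}
    {U : Set (TangentBundle 𝓘(ℝ, E) M)} (hΓ : IsGeodesicFlowOn g Γ U (Ioo a b))
    (h₀ : 0 ∈ Ioo a b) (h₁ : 1 ∈ Ioo a b) (hv : (⟨x, v⟩ : TangentBundle 𝓘(ℝ, E) M) ∈ U) :
    IsUnitGeodesicFrom g x v (Γ ⟨x, v⟩) :=
  ⟨a, b, h₀.1, h₁.2, hΓ.isGeodesicOn _ hv, hΓ.tangentLift_zero _ hv⟩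

theorem exists_Ioo_mapsTo_mul (h₀ : 0 ∈ Ioo a b) (hs : s ∈ Ioo a b) :
    ∃ c < 0, ∃ d > 1, MapsTo (s * ·) (Ioo c d) (Ioo a b) := by
  have hconn : OrdConnected ((s * ·) ⁻¹' Ioo a b) :=
    ((convex_Ioo a b).linear_preimage (LinearMap.mulLeft ℝ s)).ordConnected
  have hopen : IsOpen ((s * ·) ⁻¹' Ioo a b) := isOpen_Ioo.preimage (continuous_const_mul s)
  have hzero : ∀ᶠ τ in 𝓝 0, s * τ ∈ Ioo a b := hopen.mem_nhds (by simpa using h₀)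
  have hone : ∀ᶠ τ in 𝓝 1, s * τ ∈ Ioo a b := hopen.mem_nhds (by simpa using hs)
  obtain ⟨c, hcmem, hc⟩ :=
    ((hzero.filter_mono (nhdsWithin_le_nhds (s := Iio 0))).and self_mem_nhdsWithin).exists
  obtain ⟨d, hdmem, hd⟩ :=
    ((hone.filter_mono (nhdsWithin_le_nhds (s := Ioi 1))).and self_mem_nhdsWithin).exists
  exact ⟨c, hc, d, hd, fun τ hτ ↦ hconn.out hcmem hdmem (Ioo_subset_Icc_self hτ)⟩

variable [FiniteDimensional ℝ E]

theorem IsGeodesicOn.isUnitGeodesicFrom_comp_mul (h : IsGeodesicOn g γ (Ioo a b))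
    (h₀ : 0 ∈ Ioo a b) (hlift : tangentLift E γ 0 = ⟨x, v⟩) (hs : s ∈ Ioo a b) :
    IsUnitGeodesicFrom g x (s • v) (fun τ ↦ γ (s * τ)) := by
  obtain ⟨c, hc, d, hd, hmaps⟩ := exists_Ioo_mapsTo_mul h₀ hs
  refine ⟨c, d, hc, hd, ?_, ?_⟩
  · simpa only [add_zero] using h.comp_mul_add (a := s) (r := 0) isOpen_Ioo
      (by simpa only [add_zero] using hmaps)
  · have hscaled := tangentLift_comp_mul (E := E) (γ := γ) (s := s) (t := 0)
      (h.mdifferentiableAt (by simpa only [mul_zero] using isOpen_Ioo.mem_nhds h₀))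
    rw [mul_zero, hlift] at hscaled
    exact hscaled

variable [T2Space M]

theorem expMap_eq (h : IsUnitGeodesicFrom g x v γ) : expMap g x v = γ 1 := by
  have hex : ∃ γ : ℝ → M, IsUnitGeodesicFrom g x v γ := ⟨γ, h⟩
  have hchoose : expMap g x v = hex.choose 1 := dif_pos hex
  rw [hchoose]
  obtain ⟨a₁, b₁, ha₁, hb₁, hγ₁, hlift₁⟩ := hex.choose_spec
  obtain ⟨a₂, b₂, ha₂, hb₂, hγ₂, hlift₂⟩ := h
  refine congrArg Bundle.TotalSpace.proj ((hγ₁.mono inter_subset_left).eqOn_tangentLift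
    (hγ₂.mono inter_subset_right) (isOpen_Ioo.inter isOpen_Ioo)
    (ordConnected_Ioo.inter ordConnected_Ioo).isPreconnected (t := 0) ?_
    (hlift₁.trans hlift₂.symm) ?_)
  · exact ⟨⟨ha₁, by linarith⟩, ha₂, by linarith⟩
  · exact ⟨⟨by linarith, hb₁⟩, by linarith, hb₂⟩

theorem IsGeodesicOn.expMap_smul (h : IsGeodesicOn g γ (Ioo a b)) (h₀ : 0 ∈ Ioo a b)
    (hlift : tangentLift E γ 0 = ⟨x, v⟩) (hs : s ∈ Ioo a b) :
    expMap g x (s • v) = γ s := by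
  rw [expMap_eq (h.isUnitGeodesicFrom_comp_mul h₀ hlift hs), mul_one]

theorem exists_isGeodesicFlowOn_of_mem_expDomain (hv : v ∈ expDomain g x) :
    ∃ c d U Γ, (0 ∈ Ioo c d ∧ 1 ∈ Ioo c d) ∧ (⟨x, v⟩ : TangentBundle 𝓘(ℝ, E) M) ∈ U ∧
      IsGeodesicFlowOn g Γ U (Ioo c d) := by
  obtain ⟨γ, a, b, ha, hb, hγ, hlift⟩ := hv
  obtain ⟨U, hU, c, d, Γ, h₀, h₁, hΓ⟩ := hγ.exists_isGeodesicFlowOn (t := 0) (t' := 1)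
    ⟨ha, by linarith⟩ ⟨by linarith, hb⟩
  rw [sub_zero] at h₁
  exact ⟨c, d, U, Γ, ⟨h₀, h₁⟩, hlift ▸ mem_of_mem_nhds hU, hΓ⟩

theorem isOpen_expDomain (g : Metric E M) (x : M) : IsOpen (expDomain g x) := by
  refine isOpen_iff_mem_nhds (X := E).2 fun v hv ↦ ?_
  obtain ⟨c, d, U, Γ, ⟨h₀, h₁⟩, hU, hΓ⟩ := exists_isGeodesicFlowOn_of_mem_expDomain hv
  filter_upwards [(mdifferentiable_totalSpaceMk (E := E) x v).continuousAt.preimage_mem_nhds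
    (hΓ.isOpen.mem_nhds hU)] with w hw using ⟨_, hΓ.isUnitGeodesicFrom h₀ h₁ hw⟩

theorem mdifferentiableAt_expMap (hv : v ∈ expDomain g x) :
    MDifferentiableAt 𝓘(ℝ, E) 𝓘(ℝ, E) (fun w : E ↦ expMap g x w) v := by
  have : IsManifold 𝓘(ℝ, E) 1 M := .of_le (n := ∞) (by simp)
  obtain ⟨c, d, U, Γ, ⟨h₀, h₁⟩, hU, hΓ⟩ := exists_isGeodesicFlowOn_of_mem_expDomain hv
  have hmk := mdifferentiable_totalSpaceMk (E := E) x v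
  have hgerm : (fun w : E ↦ expMap g x w) =ᶠ[𝓝 v]
      fun w : E ↦ (tangentLift E (Γ ⟨x, w⟩) 1).proj := by
    filter_upwards [hmk.continuousAt.preimage_mem_nhds (hΓ.isOpen.mem_nhds hU)] with w hw
      using expMap_eq (hΓ.isUnitGeodesicFrom h₀ h₁ hw)
  exact ((Bundle.mdifferentiableAt_proj _).comp v
    ((hΓ.mdifferentiableAt _ hU 1 h₁).comp v hmk)).congr_of_eventuallyEq hgerm

theorem IsGeodesicOn.tangentLift_eq_mfderiv_expMap (h : IsGeodesicOn g γ (Ioo a b))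
    (h₀ : 0 ∈ Ioo a b) (hlift : tangentLift E γ 0 = ⟨x, v⟩) (hs : s ∈ Ioo a b) :
    tangentLift E γ s = ⟨expMap g x (s • v),
      mfderiv 𝓘(ℝ, E) 𝓘(ℝ, E) (fun w : E ↦ expMap g x w) (s • v) v⟩ := by
  have hd : MDifferentiableAt 𝓘(ℝ, E) 𝓘(ℝ, E) (fun w : E ↦ expMap g x w) (s • v) :=
    mdifferentiableAt_expMap ⟨_, h.isUnitGeodesicFrom_comp_mul h₀ hlift hs⟩
  have hray : HasFDerivAt (fun τ : ℝ ↦ τ • v) ((ContinuousLinearMap.id ℝ ℝ).smulRight v) s :=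
    (hasFDerivAt_id s).smul_const v
  have hgerm : γ =ᶠ[𝓝 s] fun τ ↦ expMap g x (τ • v) := by
    filter_upwards [isOpen_Ioo.mem_nhds hs] with τ hτ using (h.expMap_smul h₀ hlift hτ).symm
  have hcomp := tangentLift_eq_of_hasMFDerivAt (hd.hasMFDerivAt.comp s hray.hasMFDerivAt)
  let L : E →L[ℝ] E := mfderiv 𝓘(ℝ, E) 𝓘(ℝ, E) (fun w : E ↦ expMap g x w) (s • v)
  have hvelocity : L ((1 : ℝ) • v) = L v := congrArg L (one_smul ℝ v)
  exact ((tangentLift_congr hgerm).trans hcomp).trans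
    (congrArg (Bundle.TotalSpace.mk (F := E) (expMap g x (s • v))) hvelocity)

theorem IsGeodesicOn.mfderiv_expMap_smul_ne_zero (h : IsGeodesicOn g γ (Ioo a b))
    (h₀ : 0 ∈ Ioo a b) (hlift : tangentLift E γ 0 = ⟨x, v⟩) (hs : s ∈ Ioo a b)
    (hv : v ≠ 0) :
    mfderiv 𝓘(ℝ, E) 𝓘(ℝ, E) (fun w : E ↦ expMap g x w) (s • v) v ≠ 0 := fun hzero ↦ by
  have hs_zero : (tangentLift E γ s).2 = 0 := by
    rw [h.tangentLift_eq_mfderiv_expMap h₀ hlift hs]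
    exact hzero
  have h_zero := h.tangentLift_snd_eq_zero isOpen_Ioo isPreconnected_Ioo hs h₀ hs_zero
  rw [hlift] at h_zero
  exact hv h_zero

theorem exists_mfderiv_expMap_ne_zero [Nontrivial E] (hv : v ∈ expDomain g x) :
    ∃ u, mfderiv 𝓘(ℝ, E) 𝓘(ℝ, E) (fun w : E ↦ expMap g x w) v u ≠ 0 := by
  rcases eq_or_ne v 0 with rfl | hv₀
  · obtain ⟨u, hu⟩ := exists_ne (0 : E)
    obtain ⟨ε, hε, U, hU, Γ, hΓ⟩ := exists_isGeodesicFlowOn g ⟨x, u⟩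
    have hmem := mem_of_mem_nhds hU
    have h₀ : 0 ∈ Ioo (-ε) ε := ⟨neg_lt_zero.2 hε, hε⟩
    refine ⟨u, ?_⟩
    have hne := (hΓ.isGeodesicOn _ hmem).mfderiv_expMap_smul_ne_zero h₀
      (hΓ.tangentLift_zero _ hmem) h₀ hu
    rwa [zero_smul] at hne
  · obtain ⟨γ, a, b, ha, hb, hγ, hlift⟩ := hv
    refine ⟨v, ?_⟩
    have hne := hγ.mfderiv_expMap_smul_ne_zero (s := 1) ⟨ha, by linarith⟩ hlift
      ⟨by linarith, hb⟩ hv₀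
    rwa [one_smul] at hne

end ExponentialMap

end RiemannianExp

end

theorem mainTheorem5
    {E : Type*} [NormedAddCommGroup E] [NormedSpace ℝ E] [FiniteDimensional ℝ E]
    (hdim : 0 < Module.finrank ℝ E)
    {M : Type*} [TopologicalSpace M] [T2Space M] [ChartedSpace E M] [IsManifold 𝓘(ℝ, E) ∞ M]
    (g : RiemannianExp.Metric E M) (x : M) :
    IsOpen (RiemannianExp.expDomain g x) ∧
    ∀ v : E, v ∈ RiemannianExp.expDomain g x →
      MDifferentiableAt 𝓘(ℝ, E) 𝓘(ℝ, E) (fun w : E ↦ RiemannianExp.expMap g x w) v ∧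
      Module.finrank ℝ
          (LinearMap.ker
            (mfderiv 𝓘(ℝ, E) 𝓘(ℝ, E) (fun w : E ↦ RiemannianExp.expMap g x w) v).toLinearMap)
        < Module.finrank ℝ E := by
  refine ⟨RiemannianExp.isOpen_expDomain g x, fun v hv ↦
    ⟨RiemannianExp.mdifferentiableAt_expMap hv, ?_⟩⟩
  have : Nontrivial E := Module.finrank_pos_iff.1 hdim
  obtain ⟨u, hu⟩ := RiemannianExp.exists_mfderiv_expMap_ne_zero hv
  exact Submodule.finrank_lt (K := ℝ) (V := E) fun htop ↦
    hu (LinearMap.mem_ker.1 (htop.ge Submodule.mem_top))
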